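/- Let $E_0$ be a totally real number field or $E_0=\mathbb{R}$, let $E$ be an imaginary quadratic extension of $E_0$ (that is, $[E:E_0]=2$ and $E$ is totally imaginary; $E\cong\mathbb{C}$ if $E_0=\mathbb{R}$), and let $\alpha\mapsto\bar\alpha$ be the nontrivial element of $\mathrm{Gal}(E/E_0)$. Let $\delta\in E_0$, $\delta\neq 0$, let $n,k$ be integers with $1\le k\le n$, and let $W=E^{2n}$ with standard basis $e_1,\dots,e_{2n}$, the bilinear form $b(z,w)=\sum_{i=1}^n(z_iw_{n+i}+z_{n+i}w_i)$ and the Hermitian form $$\psi_{\delta,k}(z,w)=\sum_{i=1}^{k}\delta z_i\bar w_i+\sum_{i=k+1}^{n}z_i\bar w_i-\sum_{i=1}^{k}z_{n+i}\bar w_{n+i}-\sum_{i=k+1}^{n}\delta z_{n+i}\bar w_{n+i}.$$ Let $G_{\delta,k}$ be the algebraic group over $E_0$ of $E$-linear automorphisms of $W$ that have determinant $1$ and preserve $b$ and $\psi_{\delta,k}$. Let $G_1=\widetilde G_{\delta,k}$ be its spin double cover: the neutral component of the preimage of $G_{\delta,k}$ under $\mathrm{Res}_{E/E_0}\mathrm{Spin}(W,b)\to\mathrm{Res}_{E/E_0}\mathrm{SO}(W,b)$.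 Here $\mathrm{Spin}(W,b)$ is taken inside the Clifford algebra of the quadratic form $w\mapsto\frac12 b(w,w)=\sum_{i=1}^n w_iw_{n+i}$. Let $W_1$ be the span of $e_1,\dots,e_n$, and let $S^+=\bigwedge^{\mathrm{even}}W_1$ be the half spin representation: $e_i$ acts on $\bigwedge^\bullet W_1$ by wedge product with $e_i$, and $e_{n+i}$ by interior product with the functional on $W_1$ that sends $e_i$ to $1$ and the other $e_j$, $1\le j\le n$, to $0$, for $1\le i\le n$. If $n=2m$ is even and $m\equiv k\pmod 2$, then $S^+$ is defined over $E_0$ as a representation of $G_1$: there are a finite-dimensional algebraic representation $V$ of $G_1$ over $E_0$ and a $G_1$-equivariant isomorphism of $E$-vector spaces $E\otimes_{E_0}V\cong S^+$. (Equivariance is understood functorially, for the points of $G_1$ with values in every commutative $E_0$-algebra.) In particular, for $k=1$ and $n=6$, the representation $S^+$ of $G_1=\widetilde G_{\delta,1}$ is defined over $E_0$. -/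

import Mathlib

open scoped TensorProduct

universe u

noncomputable section

namespace HalfSpin

/-! ### The split quadratic space and its Clifford algebra, over any commutative ring -/

/-- `A ^ (2n)`; the index `Sum.inl i` stands for the basis vector `e_i` and
`Sum.inr i` for `e_{n+i}`. -/
abbrev W (A : Type u) (n : ℕ) : Type u := Fin n ⊕ Fin n → A

/-- The bilinear form `b(z, w) = ∑ (z_i w_{n+i} + z_{n+i} w_i)`. -/
def b {A : Type u} [CommRing A] {n : ℕ} (z w : W A n) : A :=
  ∑ i : Fin n, (z (Sum.inl i) * w (Sum.inr i) + z (Sum.inr i) * w (Sum.inl i))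

/-- The quadratic form `w ↦ b(w, w) / 2 = ∑ w_i w_{n+i}`. In its Clifford algebra,
`e_i e_{n+i} + e_{n+i} e_i = 1`. -/
def Q (A : Type u) [CommRing A] (n : ℕ) : QuadraticForm A (W A n) :=
  ∑ i : Fin n, QuadraticMap.linMulLin (LinearMap.proj (Sum.inl i)) (LinearMap.proj (Sum.inr i))

theorem Q_apply {A : Type u} [CommRing A] {n : ℕ} (w : W A n) :
    Q A n w = ∑ i : Fin n, w (Sum.inl i) * w (Sum.inr i) := by
  simp [Q]

theorem polar_Q {A : Type u} [CommRing A] {n : ℕ} (z w : W A n) :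
    QuadraticMap.polar (Q A n) z w = b z w := by
  simp only [QuadraticMap.polar, Q_apply, b, Pi.add_apply, ← Finset.sum_sub_distrib]
  exact Finset.sum_congr rfl fun i _ => by ring

/-- The Clifford algebra of `(A ^ (2n), Q)`. -/
abbrev Cl (A : Type u) [CommRing A] (n : ℕ) : Type u := CliffordAlgebra (Q A n)

/-- The points with values in `A` of the spin group: the invertible even elements `x` of the
Clifford algebra with `x x* = x* x = 1` and `x W x⁻¹ = W`. -/
def Spin (A : Type u) [CommRing A] (n : ℕ) : Subgroup (Cl A n)ˣ where
  carrier := {x | (x : Cl A n) ∈ CliffordAlgebra.even (Q A n) ∧ (x : Cl A n) ∈ unitary (Cl A n) ∧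
    (∀ w, ∃ w', (x : Cl A n) * CliffordAlgebra.ι (Q A n) w * ((x⁻¹ : (Cl A n)ˣ) : Cl A n) =
      CliffordAlgebra.ι (Q A n) w') ∧
    (∀ w, ∃ w', ((x⁻¹ : (Cl A n)ˣ) : Cl A n) * CliffordAlgebra.ι (Q A n) w * (x : Cl A n) =
      CliffordAlgebra.ι (Q A n) w')}
  one_mem' := ⟨one_mem _, one_mem _, fun w => ⟨w, by simp⟩, fun w => ⟨w, by simp⟩⟩
  mul_mem' := by
    rintro x y ⟨hx1, hx2, hx3, hx4⟩ ⟨hy1, hy2, hy3, hy4⟩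
    refine ⟨mul_mem hx1 hy1, mul_mem hx2 hy2, fun w => ?_, fun w => ?_⟩
    · obtain ⟨w', hw'⟩ := hy3 w
      obtain ⟨w'', hw''⟩ := hx3 w'
      exact ⟨w'', by rw [← hw'', ← hw']; simp [mul_assoc]⟩
    · obtain ⟨w', hw'⟩ := hx4 w
      obtain ⟨w'', hw''⟩ := hy4 w'
      exact ⟨w'', by rw [← hw'', ← hw']; simp [mul_assoc]⟩
  inv_mem' := by
    rintro x ⟨hx1, hx2, hx3, hx4⟩
    have hs : ((x⁻¹ : (Cl A n)ˣ) : Cl A n) = star (x : Cl A n) :=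
      Units.inv_eq_of_mul_eq_one_right hx2.2
    refine ⟨?_, ?_, hx4, by simpa using hx3⟩
    · rw [hs]
      dsimp only [CliffordAlgebra.even] at hx1 ⊢
      simp only [Submodule.mem_toSubalgebra] at hx1 ⊢
      simp only [CliffordAlgebra.star_def, CliffordAlgebra.reverse_mem_evenOdd_iff,
        CliffordAlgebra.involute_mem_evenOdd_iff, hx1]
    · rw [hs]; exact Unitary.star_mem hx2

/-! ### The half spin representation -/

/-- The exterior algebra of `W₁ = A ^ n`, the span of `e_1, …, e_n`. -/
abbrev Ext (A : Type u) [CommRing A] (n : ℕ) : Type u := ExteriorAlgebra A (Fin n → A)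

/-- The linear functional `x ↦ ∑ y_i x_i` on `W₁` given by `∑ y_i e_{n+i}`. -/
def toDual (A : Type u) [CommRing A] (n : ℕ) : (Fin n → A) →ₗ[A] Module.Dual A (Fin n → A) :=
  ∑ i : Fin n, (LinearMap.proj i : (Fin n → A) →ₗ[A] A).smulRight
    (LinearMap.proj i : (Fin n → A) →ₗ[A] A)

/-- A vector of `W` acts on `⋀ W₁`: `e_i` by the wedge product with `e_i`, and `e_{n+i}` by the
interior product with `e_{n+i}`, viewed as an element of the dual of `W₁`. -/
def vecAct (A : Type u) [CommRing A] (n : ℕ) : W A n →ₗ[A] Module.End A (Ext A n) :=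
  LinearMap.mul A (Ext A n) ∘ₗ ExteriorAlgebra.ι A ∘ₗ LinearMap.funLeft A A Sum.inl +
    CliffordAlgebra.contractLeft ∘ₗ toDual A n ∘ₗ LinearMap.funLeft A A Sum.inr

theorem vecAct_apply {A : Type u} [CommRing A] {n : ℕ} (w : W A n) (s : Ext A n) :
    vecAct A n w s = ExteriorAlgebra.ι A (fun i => w (Sum.inl i)) * s +
      CliffordAlgebra.contractLeft (toDual A n (fun i => w (Sum.inr i))) s := rfl

theorem vecAct_mul_self {A : Type u} [CommRing A] {n : ℕ} (w : W A n) :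
    vecAct A n w * vecAct A n w = algebraMap A (Module.End A (Ext A n)) (Q A n w) := by
  refine LinearMap.ext fun s => ?_
  have h0 : ExteriorAlgebra.ι A (fun i => w (Sum.inl i)) *
      (ExteriorAlgebra.ι A (fun i => w (Sum.inl i)) * s) = 0 := by
    rw [← mul_assoc, ExteriorAlgebra.ι_sq_zero, zero_mul]
  have h1 := CliffordAlgebra.contractLeft_ι_mul (Q := (0 : QuadraticForm A (Fin n → A)))
    (toDual A n (fun i => w (Sum.inr i))) (fun i => w (Sum.inl i)) s
  have h2 : toDual A n (fun i => w (Sum.inr i)) (fun i => w (Sum.inl i)) = Q A n w := by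
    rw [Q_apply]
    simp [toDual, mul_comm]
  rw [Module.End.mul_apply, vecAct_apply, vecAct_apply, mul_add, h0, map_add,
    CliffordAlgebra.contractLeft_contractLeft, Module.algebraMap_end_apply, ← h2]
  erw [h1]
  simp [ExteriorAlgebra.ι]

/-- The action of the Clifford algebra of `W` on `⋀ W₁`. -/
def spinAct (A : Type u) [CommRing A] (n : ℕ) : Cl A n →ₐ[A] Module.End A (Ext A n) :=
  CliffordAlgebra.lift (Q A n) ⟨vecAct A n, vecAct_mul_self⟩

/-- The space `S⁺ = ⋀^even W₁`. -/
def SPlus (A : Type u) [CommRing A] (n : ℕ) : Submodule A (Ext A n) :=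
  CliffordAlgebra.evenOdd (0 : QuadraticForm A (Fin n → A)) 0

theorem contractLeft_mem {A : Type u} [CommRing A] {n : ℕ} (d : Module.Dual A (Fin n → A))
    (i : ZMod 2) (s : Ext A n)
    (hs : s ∈ CliffordAlgebra.evenOdd (0 : QuadraticForm A (Fin n → A)) i) :
    CliffordAlgebra.contractLeft d s ∈
      CliffordAlgebra.evenOdd (0 : QuadraticForm A (Fin n → A)) (i + 1) := by
  induction s, hs using CliffordAlgebra.evenOdd_induction with
  | range_ι_pow v h =>
    have hi : i = 0 ∨ i = 1 := by clear h; revert i; decide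
    rcases hi with rfl | rfl
    · obtain ⟨r, rfl⟩ := Submodule.mem_one.mp (by simpa using h)
      rw [CliffordAlgebra.contractLeft_algebraMap]
      exact Submodule.zero_mem _
    · have h' : v ∈ LinearMap.range (CliffordAlgebra.ι (0 : QuadraticForm A (Fin n → A))) := by
        have : (1 : ZMod 2).val = 1 := rfl
        simpa [this] using h
      obtain ⟨m, rfl⟩ := h'
      rw [CliffordAlgebra.contractLeft_ι]
      exact SetLike.algebraMap_mem_graded
        (CliffordAlgebra.evenOdd (0 : QuadraticForm A (Fin n → A))) (d m)
  | add x y hx hy ihx ihy => rw [map_add]; exact Submodule.add_mem _ ihx ihy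
  | ι_mul_ι_mul m₁ m₂ x hx ih =>
    have hstep : ∀ (j : ZMod 2) (m : Fin n → A) (y : Ext A n),
        y ∈ CliffordAlgebra.evenOdd (0 : QuadraticForm A (Fin n → A)) j →
        CliffordAlgebra.ι (0 : QuadraticForm A (Fin n → A)) m * y ∈
          CliffordAlgebra.evenOdd (0 : QuadraticForm A (Fin n → A)) (j + 1) := by
      intro j m y hy
      rw [add_comm]
      exact SetLike.mul_mem_graded (CliffordAlgebra.ι_mem_evenOdd_one _ m) hy
    have h2 : i + 1 + 1 = i := by rw [add_assoc]; exact (congrArg (i + ·) (by decide)).trans (add_zero i)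
    rw [mul_assoc, CliffordAlgebra.contractLeft_ι_mul, CliffordAlgebra.contractLeft_ι_mul]
    refine Submodule.sub_mem _ (Submodule.smul_mem _ _ (hstep _ _ _ hx)) (hstep _ _ _ ?_)
    refine Submodule.sub_mem _ (Submodule.smul_mem _ _ hx) ?_
    have := hstep _ m₂ _ ih
    rwa [h2] at this

theorem vecAct_mem {A : Type u} [CommRing A] {n : ℕ} (w : W A n) (i : ZMod 2) (s : Ext A n)
    (hs : s ∈ CliffordAlgebra.evenOdd (0 : QuadraticForm A (Fin n → A)) i) :
    vecAct A n w s ∈ CliffordAlgebra.evenOdd (0 : QuadraticForm A (Fin n → A)) (i + 1) := by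
  rw [vecAct_apply]
  refine Submodule.add_mem _ ?_ (contractLeft_mem _ _ _ hs)
  rw [add_comm]
  exact SetLike.mul_mem_graded (CliffordAlgebra.ι_mem_evenOdd_one _ _) hs

theorem spinAct_mem {A : Type u} [CommRing A] {n : ℕ} (x : Cl A n)
    (hx : x ∈ CliffordAlgebra.even (Q A n)) (s : Ext A n) (hs : s ∈ SPlus A n) :
    spinAct A n x s ∈ SPlus A n := by
  have hx' : x ∈ CliffordAlgebra.evenOdd (Q A n) 0 := hx
  clear hx
  induction x, hx' using CliffordAlgebra.even_induction with
  | algebraMap r =>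
    rw [AlgHom.commutes, Module.algebraMap_end_apply]
    exact Submodule.smul_mem _ _ hs
  | add x y hx hy ihx ihy =>
    rw [map_add, LinearMap.add_apply]
    exact Submodule.add_mem _ ihx ihy
  | ι_mul_ι_mul m₁ m₂ x hx ih =>
    have h := vecAct_mem m₁ _ _ (vecAct_mem m₂ 0 _ ih)
    have h2 : (0 : ZMod 2) + 1 + 1 = 0 := by decide
    rw [h2] at h
    simpa [spinAct, SPlus] using h

/-- The half spin representation of the spin group on `S⁺`. -/
def halfSpin (A : Type u) [CommRing A] (n : ℕ) : Spin A n →* Module.End A (SPlus A n) where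
  toFun x := (spinAct A n ((x : (Cl A n)ˣ) : Cl A n)).restrict
    fun s hs => spinAct_mem _ x.2.1 s hs
  map_one' := by
    refine LinearMap.ext fun s => Subtype.ext ?_
    simp
  map_mul' x y := by
    refine LinearMap.ext fun s => Subtype.ext ?_
    simp

/-! ### Change of rings -/

/-- The ring homomorphism `C(A ^ (2n), Q) → C(B ^ (2n), Q)` induced by `f : A → B`. -/
def clMap {A B : Type u} [CommRing A] [CommRing B] (f : A →+* B) (n : ℕ) : Cl A n →+* Cl B n :=
  letI : Algebra A B := f.toAlgebra
  (CliffordAlgebra.lift (Q A n)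
    ⟨((CliffordAlgebra.ι (Q B n)).restrictScalars A) ∘ₗ
      (Algebra.linearMap A B).compLeft (Fin n ⊕ Fin n), fun w => by
        have h : Q B n (fun j => algebraMap A B (w j)) = algebraMap A B (Q A n w) := by
          simp [Q_apply]
        rw [LinearMap.comp_apply, LinearMap.restrictScalars_apply, CliffordAlgebra.ι_sq_scalar,
          IsScalarTower.algebraMap_apply A B (Cl B n), ← h]
        rfl⟩).toRingHom

theorem clMap_ι {A B : Type u} [CommRing A] [CommRing B] (f : A →+* B) (n : ℕ) (w : W A n) :
    clMap f n (CliffordAlgebra.ι (Q A n) w) = CliffordAlgebra.ι (Q B n) (fun j => f (w j)) := by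
  let _ : Algebra A B := f.toAlgebra
  exact CliffordAlgebra.lift_ι_apply _ _ w

theorem clMap_algebraMap {A B : Type u} [CommRing A] [CommRing B] (f : A →+* B) (n : ℕ) (a : A) :
    clMap f n (algebraMap A (Cl A n) a) = algebraMap B (Cl B n) (f a) := by
  let _ : Algebra A B := f.toAlgebra
  exact (AlgHom.commutes _ a).trans (IsScalarTower.algebraMap_apply A B (Cl B n) a)

/-- The ring homomorphism `⋀ A ^ n → ⋀ B ^ n` induced by `f : A → B`. -/
def extMap {A B : Type u} [CommRing A] [CommRing B] (f : A →+* B) (n : ℕ) : Ext A n →+* Ext B n :=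
  letI : Algebra A B := f.toAlgebra
  (ExteriorAlgebra.lift A
    ⟨((ExteriorAlgebra.ι B).restrictScalars A) ∘ₗ (Algebra.linearMap A B).compLeft (Fin n),
      fun w => by
        rw [LinearMap.comp_apply, LinearMap.restrictScalars_apply, ExteriorAlgebra.ι_sq_zero]⟩
    ).toRingHom

theorem extMap_ι {A B : Type u} [CommRing A] [CommRing B] (f : A →+* B) (n : ℕ) (w : Fin n → A) :
    extMap f n (ExteriorAlgebra.ι A w) = ExteriorAlgebra.ι B (fun j => f (w j)) := by
  let _ : Algebra A B := f.toAlgebra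
  exact ExteriorAlgebra.lift_ι_apply A _ _ w

theorem extMap_algebraMap {A B : Type u} [CommRing A] [CommRing B] (f : A →+* B) (n : ℕ) (a : A) :
    extMap f n (algebraMap A (Ext A n) a) = algebraMap B (Ext B n) (f a) := by
  let _ : Algebra A B := f.toAlgebra
  exact (AlgHom.commutes _ a).trans (IsScalarTower.algebraMap_apply A B (Ext B n) a)

theorem extMap_mem {A B : Type u} [CommRing A] [CommRing B] (f : A →+* B) (n : ℕ) (s : Ext A n)
    (hs : s ∈ SPlus A n) : extMap f n s ∈ SPlus B n := by
  induction s, hs using CliffordAlgebra.even_induction with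
  | algebraMap r =>
    have := extMap_algebraMap f n r
    erw [this]
    exact SetLike.algebraMap_mem_graded _ _
  | add x y hx hy ihx ihy => rw [map_add]; exact Submodule.add_mem _ ihx ihy
  | ι_mul_ι_mul m₁ m₂ x hx ih =>
    have h1 := extMap_ι f n m₁
    have h2 := extMap_ι f n m₂
    rw [map_mul, map_mul]
    erw [h1, h2]
    have h := SetLike.mul_mem_graded
      (CliffordAlgebra.ι_mul_ι_mem_evenOdd_zero (0 : QuadraticForm B (Fin n → B))
        (fun j => f (m₁ j)) (fun j => f (m₂ j))) ih
    rwa [add_zero] at h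

/-- The map `S⁺(A) → S⁺(B)` induced by `f : A → B`; it makes `S⁺(B)` the extension of scalars
of `S⁺(A)`. -/
def sPlusMap {A B : Type u} [CommRing A] [CommRing B] (f : A →+* B) (n : ℕ) :
    SPlus A n →ₛₗ[f] SPlus B n where
  toFun s := ⟨extMap f n s, extMap_mem f n s s.2⟩
  map_add' s t := Subtype.ext (by simp)
  map_smul' a s := Subtype.ext (by
    simp only [Submodule.coe_smul, Algebra.smul_def, map_mul, extMap_algebraMap])

/-! ### The Zariski topology -/

/-- The algebra of polynomial functions on a `K`-vector space. -/
def polyFun (K M : Type u) [CommRing K] [AddCommGroup M] [Module K M] : Subalgebra K (M → K) :=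
  Algebra.adjoin K (Set.range fun d : Module.Dual K M => (d : M → K))

/-- The Zariski topology on a `K`-vector space: the sets `{p ≠ 0}`, for polynomial functions `p`,
are a basis of open sets. -/
abbrev zariski (K M : Type u) [CommRing K] [AddCommGroup M] [Module K M] : TopologicalSpace M :=
  TopologicalSpace.generateFrom {U | ∃ p ∈ polyFun K M, U = {x | p x ≠ 0}}

theorem polyFun_comp {K M N : Type u} [CommRing K] [AddCommGroup M] [Module K M]
    [AddCommGroup N] [Module K N] (L : M →ₗ[K] N) (p : N → K) (hp : p ∈ polyFun K N) :
    p ∘ L ∈ polyFun K M := by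
  unfold polyFun at hp
  induction hp using Algebra.adjoin_induction with
  | mem p hp =>
    obtain ⟨d, rfl⟩ := hp
    exact Algebra.subset_adjoin ⟨d ∘ₗ L, rfl⟩
  | algebraMap r => exact Subalgebra.algebraMap_mem (polyFun K M) r
  | add p q _ _ hp hq => exact Subalgebra.add_mem (polyFun K M) hp hq
  | mul p q _ _ hp hq => exact Subalgebra.mul_mem (polyFun K M) hp hq

theorem continuous_zariski {K M N : Type u} [CommRing K] [AddCommGroup M] [Module K M]
    [AddCommGroup N] [Module K N] (L : M →ₗ[K] N) :
    @Continuous M N (zariski K M) (zariski K N) L := by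
  let _ := zariski K M
  refine continuous_generateFrom_iff.2 ?_
  rintro _ ⟨p, hp, rfl⟩
  exact TopologicalSpace.isOpen_generateFrom_of_mem ⟨_, polyFun_comp L p hp, rfl⟩

/-! ### The unitary group and its spin double cover -/

section Groups

variable {E₀ E : Type u} [Field E₀] [Field E] [Algebra E₀ E]

/-- The conjugation of `R ⊗ E` induced by an automorphism `σ` of `E` over `E₀`. -/
def conj (σ : E ≃ₐ[E₀] E) (R : Type u) [CommRing R] [Algebra E₀ R] :
    R ⊗[E₀] E →ₐ[R] R ⊗[E₀] E :=
  Algebra.TensorProduct.map (AlgHom.id R R) (σ : E →ₐ[E₀] E)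

/-- The coefficients `a_1, …, a_{2n}` of `ψ_{δ,k}`. -/
def coeff (δ : E₀) (k n : ℕ) : Fin n ⊕ Fin n → E₀ :=
  Sum.elim (fun i => if (i : ℕ) < k then δ else 1) (fun i => if (i : ℕ) < k then -1 else -δ)

/-- The Hermitian form `ψ_{δ,k}(z, w) = ∑ a_j z_j σ(w_j)`, extended to `R ⊗ W`. -/
def psi (σ : E ≃ₐ[E₀] E) (δ : E₀) (k n : ℕ) (R : Type u) [CommRing R] [Algebra E₀ R]
    (z w : W (R ⊗[E₀] E) n) : R ⊗[E₀] E :=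
  ∑ j, algebraMap E₀ (R ⊗[E₀] E) (coeff δ k n j) * z j * conj σ R (w j)

/-- The points with values in `R` of the algebraic group `G_{δ,k}` over `E₀`: the automorphisms of
`R ⊗ W` over `R ⊗ E` that have determinant one and preserve `b` and `ψ_{δ,k}`. -/
def G (σ : E ≃ₐ[E₀] E) (δ : E₀) (k n : ℕ) (R : Type u) [CommRing R] [Algebra E₀ R] :
    Subgroup (W (R ⊗[E₀] E) n ≃ₗ[R ⊗[E₀] E] W (R ⊗[E₀] E) n) where
  carrier := {g | LinearMap.det (g : W (R ⊗[E₀] E) n →ₗ[R ⊗[E₀] E] W (R ⊗[E₀] E) n) = 1 ∧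
    (∀ z w, b (g z) (g w) = b z w) ∧ (∀ z w, psi σ δ k n R (g z) (g w) = psi σ δ k n R z w)}
  one_mem' := ⟨LinearMap.det_id, fun _ _ => rfl, fun _ _ => rfl⟩
  mul_mem' := by
    rintro g h ⟨hg1, hg2, hg3⟩ ⟨hh1, hh2, hh3⟩
    refine ⟨?_, fun z w => ?_, fun z w => ?_⟩
    · exact (LinearMap.det_comp _ _).trans (by rw [hg1, hh1, one_mul])
    · exact (hg2 _ _).trans (hh2 _ _)
    · exact (hg3 _ _).trans (hh3 _ _)
  inv_mem' := by
    rintro g ⟨hg1, hg2, hg3⟩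
    have hi : ∀ z, g (g⁻¹ z) = z := fun z => g.apply_symm_apply z
    refine ⟨?_, fun z w => ?_, fun z w => ?_⟩
    · have h := LinearEquiv.det_mul_det_symm g
      rw [hg1, one_mul] at h
      exact h
    · rw [← hg2, hi, hi]
    · rw [← hg3, hi, hi]

/-- The points with values in `R` of the preimage of `G_{δ,k}` in the restriction of scalars from
`E` to `E₀` of the spin group of `(W, b)`, under `x ↦ (w ↦ x w x⁻¹)`. -/
def preG (σ : E ≃ₐ[E₀] E) (δ : E₀) (k n : ℕ) (R : Type u) [CommRing R] [Algebra E₀ R] :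
    Subgroup (Cl (R ⊗[E₀] E) n)ˣ where
  carrier := {x | x ∈ Spin (R ⊗[E₀] E) n ∧ ∃ g ∈ G σ δ k n R, ∀ w,
    (x : Cl (R ⊗[E₀] E) n) * CliffordAlgebra.ι (Q (R ⊗[E₀] E) n) w *
      ((x⁻¹ : (Cl (R ⊗[E₀] E) n)ˣ) : Cl (R ⊗[E₀] E) n) =
        CliffordAlgebra.ι (Q (R ⊗[E₀] E) n) (g w)}
  one_mem' := ⟨one_mem _, 1, one_mem _, fun w => by simp⟩
  mul_mem' := by
    rintro x y ⟨hx, g, hg, hxg⟩ ⟨hy, h, hh, hyh⟩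
    refine ⟨mul_mem hx hy, g * h, mul_mem hg hh, fun w => ?_⟩
    rw [LinearEquiv.mul_apply, ← hxg, ← hyh]
    simp [mul_assoc]
  inv_mem' := by
    rintro x ⟨hx, g, hg, hxg⟩
    refine ⟨inv_mem hx, g⁻¹, inv_mem hg, fun w => ?_⟩
    have hi : g (g⁻¹ w) = w := g.apply_symm_apply w
    have h := hxg (g⁻¹ w)
    rw [hi] at h
    rw [← h]
    simp [mul_assoc]

/-- The points with values in an algebraically closed field `K` of the neutral component of the
preimage of `G_{δ,k}`: the connected component of `1` in the Zariski topology on the `K`-points of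
the preimage, a subset of the finite-dimensional `K`-vector space `C(K ⊗ W, Q)`. -/
def neutral (σ : E ≃ₐ[E₀] E) (δ : E₀) (k n : ℕ) (K : Type u) [Field K] [Algebra E₀ K] :
    Set (Cl (K ⊗[E₀] E) n) :=
  @connectedComponentIn _ (zariski K (Cl (K ⊗[E₀] E) n)) (Units.val '' (preG σ δ k n K : Set _)) 1

theorem one_mem_neutral (σ : E ≃ₐ[E₀] E) (δ : E₀) (k n : ℕ) (K : Type u) [Field K]
    [Algebra E₀ K] : 1 ∈ neutral σ δ k n K := by
  let _ := zariski K (Cl (K ⊗[E₀] E) n)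
  exact mem_connectedComponentIn ⟨1, one_mem _, rfl⟩

theorem exists_of_mem_neutral {σ : E ≃ₐ[E₀] E} {δ : E₀} {k n : ℕ} {K : Type u} [Field K]
    [Algebra E₀ K] {y : Cl (K ⊗[E₀] E) n} (hy : y ∈ neutral σ δ k n K) :
    ∃ u ∈ preG σ δ k n K, (u : Cl (K ⊗[E₀] E) n) = y := by
  let _ := zariski K (Cl (K ⊗[E₀] E) n)
  let F : Set (Cl (K ⊗[E₀] E) n) := Units.val '' (preG σ δ k n K : Set _)
  have h : connectedComponentIn F 1 ⊆ F := connectedComponentIn_subset F 1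
  exact h hy

theorem inv_mul_mem_neutral {σ : E ≃ₐ[E₀] E} {δ : E₀} {k n : ℕ} {K : Type u} [Field K]
    [Algebra E₀ K] {x y : (Cl (K ⊗[E₀] E) n)ˣ} (hx : (x : Cl (K ⊗[E₀] E) n) ∈ neutral σ δ k n K)
    (hy : (y : Cl (K ⊗[E₀] E) n) ∈ neutral σ δ k n K) :
    ((x⁻¹ * y : (Cl (K ⊗[E₀] E) n)ˣ) : Cl (K ⊗[E₀] E) n) ∈ neutral σ δ k n K := by
  let _ := zariski K (Cl (K ⊗[E₀] E) n)
  obtain ⟨u, hu, hux⟩ := exists_of_mem_neutral hx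
  obtain rfl : u = x := Units.ext hux
  let L : Cl (K ⊗[E₀] E) n →ₗ[K] Cl (K ⊗[E₀] E) n :=
    LinearMap.mulLeft K ((u⁻¹ : (Cl (K ⊗[E₀] E) n)ˣ) : Cl (K ⊗[E₀] E) n)
  have hpre : IsPreconnected (L '' neutral σ δ k n K) :=
    isPreconnected_connectedComponentIn.image _ (continuous_zariski L).continuousOn
  have hsub : L '' neutral σ δ k n K ⊆ Units.val '' (preG σ δ k n K : Set _) := by
    rintro _ ⟨z, hz, rfl⟩
    obtain ⟨v, hv, rfl⟩ := exists_of_mem_neutral hz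
    exact ⟨u⁻¹ * v, mul_mem (inv_mem hu) hv, by simp [L]⟩
  refine hpre.subset_connectedComponentIn ⟨u, hx, by simp [L]⟩ hsub ⟨y, hy, by simp [L]⟩

/-- The points with values in `R` of the spin double cover of `G_{δ,k}`, which is the neutral
component of the preimage of `G_{δ,k}`: an `R`-point of the preimage belongs to this open subgroup
if and only if it does so at every geometric point of `Spec R`. -/
def G₁ (σ : E ≃ₐ[E₀] E) (δ : E₀) (k n : ℕ) (R : Type u) [CommRing R] [Algebra E₀ R] :
    Subgroup (Cl (R ⊗[E₀] E) n)ˣ where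
  carrier := {x | x ∈ preG σ δ k n R ∧
    ∀ (K : Type u) [Field K] [IsAlgClosed K] [Algebra E₀ K] (f : R →ₐ[E₀] K),
      ((Units.map (clMap (Algebra.TensorProduct.map f (AlgHom.id E₀ E)).toRingHom n : _ →* _) x :
        (Cl (K ⊗[E₀] E) n)ˣ) : Cl (K ⊗[E₀] E) n) ∈ neutral σ δ k n K}
  one_mem' := ⟨one_mem _, fun K _ _ _ f => by
    rw [map_one]; exact one_mem_neutral σ δ k n K⟩
  mul_mem' := by
    rintro x y ⟨hx, hx'⟩ ⟨hy, hy'⟩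
    refine ⟨mul_mem hx hy, fun K _ _ _ f => ?_⟩
    have h := inv_mul_mem_neutral (y := 1) (hx' K f) (one_mem_neutral σ δ k n K)
    have h' := inv_mul_mem_neutral h (hy' K f)
    simpa only [mul_one, inv_inv, map_mul] using h'
  inv_mem' := by
    rintro x ⟨hx, hx'⟩
    refine ⟨inv_mem hx, fun K _ _ _ f => ?_⟩
    have h := inv_mul_mem_neutral (y := 1) (hx' K f) (one_mem_neutral σ δ k n K)
    simpa only [mul_one, map_inv] using h

theorem G₁_le_Spin (σ : E ≃ₐ[E₀] E) (δ : E₀) (k n : ℕ) (R : Type u) [CommRing R]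
    [Algebra E₀ R] : G₁ σ δ k n R ≤ Spin (R ⊗[E₀] E) n := fun _ hx => hx.1.1

/-- The action of the spin double cover of `G_{δ,k}` on `S⁺`, for points with values in `R`. Here
`SPlus (R ⊗ E) n` is the extension of scalars of `S⁺` from `E` to `R ⊗ E`. -/
def sPlusAct (σ : E ≃ₐ[E₀] E) (δ : E₀) (k n : ℕ) (R : Type u) [CommRing R] [Algebra E₀ R] :
    G₁ σ δ k n R →* Module.End (R ⊗[E₀] E) (SPlus (R ⊗[E₀] E) n) :=
  (halfSpin (R ⊗[E₀] E) n).comp (Subgroup.inclusion (G₁_le_Spin σ δ k n R))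

/-- An algebraic representation over `E₀` of the spin double cover of `G_{δ,k}` on the
`E₀`-vector space `V`: actions of the groups of `R`-points on `R ⊗ V`, natural in the
`E₀`-algebra `R`. -/
structure Rep (σ : E ≃ₐ[E₀] E) (δ : E₀) (k n : ℕ) (V : Type u) [AddCommGroup V]
    [Module E₀ V] where
  act : ∀ (R : Type u) [CommRing R] [Algebra E₀ R],
    G₁ σ δ k n R →* Module.End R (R ⊗[E₀] V)
  natural : ∀ (R R' : Type u) [CommRing R] [Algebra E₀ R] [CommRing R'] [Algebra E₀ R']
    (f : R →ₐ[E₀] R') (g : G₁ σ δ k n R) (g' : G₁ σ δ k n R'),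
    ((g' : (Cl (R' ⊗[E₀] E) n)ˣ) : Cl (R' ⊗[E₀] E) n) =
      clMap (Algebra.TensorProduct.map f (AlgHom.id E₀ E)).toRingHom n
        ((g : (Cl (R ⊗[E₀] E) n)ˣ) : Cl (R ⊗[E₀] E) n) →
    ∀ x : R ⊗[E₀] V, act R' g' (f.toLinearMap.rTensor V x) = f.toLinearMap.rTensor V (act R g x)

/-- For an `E`-linear map `φ : E ⊗ V → S⁺`, the induced `R`-linear map from `R ⊗ V` to the
extension of scalars of `S⁺` to `R ⊗ E`; it sends `1 ⊗ v` to the image of `φ (1 ⊗ v)`. -/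
def extend {n : ℕ} {V : Type u} [AddCommGroup V] [Module E₀ V]
    (φ : E ⊗[E₀] V →ₗ[E] SPlus E n) (R : Type u) [CommRing R] [Algebra E₀ R] :
    R ⊗[E₀] V →ₗ[R] SPlus (R ⊗[E₀] E) n :=
  LinearMap.liftBaseChange R
    { toFun := fun v => sPlusMap (Algebra.TensorProduct.includeRight : E →ₐ[E₀] R ⊗[E₀] E).toRingHom
        n (φ (1 ⊗ₜ v))
      map_add' := fun v w => by rw [TensorProduct.tmul_add, map_add, map_add]
      map_smul' := fun c v => by
        rw [TensorProduct.tmul_smul, ← algebraMap_smul E c, map_smul, map_smulₛₗ, RingHom.id_apply,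
          ← algebraMap_smul (R ⊗[E₀] E) c]
        congr 1
        exact AlgHom.commutes _ c }

/-- The representation `S⁺` of the spin double cover of `G_{δ,k}` is defined over `E₀`: there are a
representation over `E₀` on a finite-dimensional vector space `V` and an isomorphism of
`E`-vector spaces `E ⊗ V ≃ S⁺` that is equivariant for the points of the group with values in
every `E₀`-algebra `R`. -/
def SPlusDefinedOver (σ : E ≃ₐ[E₀] E) (δ : E₀) (k n : ℕ) : Prop :=
  ∃ (V : Type u) (_ : AddCommGroup V) (_ : Module E₀ V) (_ : FiniteDimensional E₀ V)
    (ρ : Rep σ δ k n V) (φ : E ⊗[E₀] V ≃ₗ[E] SPlus E n),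
    ∀ (R : Type u) [CommRing R] [Algebra E₀ R] (g : G₁ σ δ k n R) (x : R ⊗[E₀] V),
      extend φ.toLinearMap R (ρ.act R g x) = sPlusAct σ δ k n R g (extend φ.toLinearMap R x)

end Groups

/-- `E` is an imaginary quadratic extension of `E₀`, where `E₀` is a totally real number field or
the field of real numbers. -/
def ImaginaryQuadratic (E₀ E : Type u) [Field E₀] [Field E] [Algebra E₀ E] : Prop :=
  Module.finrank E₀ E = 2 ∧
    ((NumberField E₀ ∧ NumberField.IsTotallyReal E₀ ∧ NumberField.IsTotallyComplex E) ∨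
      Nonempty (E₀ ≃+* ℝ))

end HalfSpin

end

noncomputable section

namespace HalfSpin

/-! ### Clifford modules and the Fock space -/

section Fock

variable {A : Type u} [CommRing A] {n : ℕ}

/-! The Hermitian form is `ψ(z, w) = b(z, T σ w)`, where `T` interchanges the lines of `e_i` and
`e_{n+i}` up to the coefficients of `ψ`. These multiply in pairs to `-δ`, so `T² = -δ` and `T` is a
similitude of `Q` with multiplier `-δ`. By nondegeneracy of `b`, an element of `G_{δ,k}` commutes
with `Tσ`. The semilinear rule `zw ↦ (-δ)⁻¹ (Tσz)(Tσw)` on the even Clifford algebra is realised on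
`⋀ W₁` by `J = c · swap ∘ σ`, normalised by `1 ↦ c · e_1 ∧ … ∧ e_n` (`exists_swap`); it preserves
`S⁺` because `n` is even.

On `S⁺` the operator `J²` commutes with the even Clifford algebra, and evaluation at `1` gives the
scalar `c² δ^(k-m)` (`swap_swap_one`). If `m ≡ k` mod 2, then `c` can be a power of `δ` that makes
`J² = 1` (`semi_semi`, `exists_sq_of_modEq`). The fixed vectors of `J` are then an `E₀`-form `V` of
`S⁺`.

It remains to see that the group commutes with `J`. For `u` above an element of `G_{δ,k}`, the
operator `u⁻¹JuJ` commutes with the even Clifford algebra, so it is a scalar `a`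
(`exists_smul_of_conj`). From `J² = 1` comes `σ(a)a = 1`, and from the invariant bilinear form on
spinors `a² = 1` (`mul_self_of_semi`); hence `a` lies in `R` and is a square root of `1`. Over a
field the loci `a = 1` and `a = -1` are closed and disjoint, so connectedness forces `a = 1` on the
neutral component (`semi_comm_of_mem_neutral`). For general `R`, an element with square `1` that
equals `1` at every geometric point is `1` (`eq_one_of_geometric`). Descent of coefficients then
shows that the `R`-points act on `R ⊗ V` (`exists_extend_eq`, `exists_act`). -/

theorem anticomm_of_sq {M : Type*} [AddCommGroup M] [Module A M] (T : W A n →ₗ[A] Module.End A M)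
    (hT : ∀ w s, T w (T w s) = Q A n w • s) (z w : W A n) (s : M) :
    T z (T w s) + T w (T z s) = b z w • s := by
  have h := hT (z + w) s
  have hb : Q A n (z + w) = b z w + Q A n z + Q A n w := by
    rw [← polar_Q, QuadraticMap.polar]; ring
  rw [hb, add_smul, add_smul, ← hT, ← hT] at h
  simp only [map_add, LinearMap.add_apply] at h
  rw [← sub_eq_zero] at h ⊢
  rw [← h]
  abel

theorem vecAct_vecAct (w : W A n) (s : Ext A n) :
    vecAct A n w (vecAct A n w s) = Q A n w • s :=
  LinearMap.congr_fun (vecAct_mul_self w) s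

theorem vecAct_anticomm (z w : W A n) (s : Ext A n) :
    vecAct A n z (vecAct A n w s) + vecAct A n w (vecAct A n z s) = b z w • s :=
  anticomm_of_sq (vecAct A n) vecAct_vecAct z w s

/-- The inclusion of `W₁` in `W`. -/
def incl₁ (A : Type u) [CommRing A] (n : ℕ) : (Fin n → A) →ₗ[A] W A n where
  toFun x := Sum.elim x 0
  map_add' x y := by ext (i | i) <;> simp
  map_smul' c x := by ext (i | i) <;> simp

/-- The inclusion of the span of `e_{n+1}, …, e_{2n}` in `W`. -/
def incl₂ (A : Type u) [CommRing A] (n : ℕ) : (Fin n → A) →ₗ[A] W A n where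
  toFun x := Sum.elim 0 x
  map_add' x y := by ext (i | i) <;> simp
  map_smul' c x := by ext (i | i) <;> simp

@[simp] theorem incl₁_inl (x : Fin n → A) (i : Fin n) : incl₁ A n x (Sum.inl i) = x i := rfl
@[simp] theorem incl₁_inr (x : Fin n → A) (i : Fin n) : incl₁ A n x (Sum.inr i) = 0 := rfl
@[simp] theorem incl₂_inl (x : Fin n → A) (i : Fin n) : incl₂ A n x (Sum.inl i) = 0 := rfl
@[simp] theorem incl₂_inr (x : Fin n → A) (i : Fin n) : incl₂ A n x (Sum.inr i) = x i := rfl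

theorem incl₁_add_incl₂ (w : W A n) :
    incl₁ A n (fun i => w (Sum.inl i)) + incl₂ A n (fun i => w (Sum.inr i)) = w := by
  ext (i | i) <;> simp

theorem vecAct_incl₁ (x : Fin n → A) (s : Ext A n) :
    vecAct A n (incl₁ A n x) s = ExteriorAlgebra.ι A x * s := by
  have : (fun i => incl₁ A n x (Sum.inr i)) = 0 := rfl
  rw [vecAct_apply, this]
  simp

theorem vecAct_incl₂ (y : Fin n → A) (s : Ext A n) :
    vecAct A n (incl₂ A n y) s = CliffordAlgebra.contractLeft (toDual A n y) s := by
  have : (fun i => incl₂ A n y (Sum.inl i)) = 0 := rfl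
  rw [vecAct_apply, this]
  simp

theorem vecAct_incl₂_one (y : Fin n → A) : vecAct A n (incl₂ A n y) 1 = 0 := by
  rw [vecAct_incl₂]
  exact CliffordAlgebra.contractLeft_one (Q := (0 : QuadraticForm A (Fin n → A))) _

theorem Q_incl₁ (x : Fin n → A) : Q A n (incl₁ A n x) = 0 := by simp [Q_apply]

theorem Q_incl₂ (x : Fin n → A) : Q A n (incl₂ A n x) = 0 := by simp [Q_apply]

/-- Induction on an element of the exterior algebra by means of the action of `W₁`. -/
theorem ext_induction {p : Ext A n → Prop} (one : p 1) (smul : ∀ (a : A) s, p s → p (a • s))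
    (add : ∀ s t, p s → p t → p (s + t)) (act : ∀ x s, p s → p (vecAct A n (incl₁ A n x) s))
    (s : Ext A n) : p s := by
  induction s using CliffordAlgebra.left_induction with
  | algebraMap r => rw [Algebra.algebraMap_eq_smul_one]; exact smul _ _ one
  | add x y hx hy => exact add _ _ hx hy
  | ι_mul x m hx => have := act m x hx; rwa [vecAct_incl₁] at this

theorem one_mem_sPlus : (1 : Ext A n) ∈ SPlus A n := SetLike.GradedOne.one_mem

/-- Induction on an element of `S⁺` by means of the action of even products. -/
theorem sPlus_induction {p : Ext A n → Prop} (one : p 1)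
    (smul : ∀ (a : A) s, s ∈ SPlus A n → p s → p (a • s))
    (add : ∀ s t, s ∈ SPlus A n → t ∈ SPlus A n → p s → p t → p (s + t))
    (act : ∀ x y s, s ∈ SPlus A n → p s →
      p (vecAct A n (incl₁ A n x) (vecAct A n (incl₁ A n y) s)))
    (s : Ext A n) (hs : s ∈ SPlus A n) : p s := by
  induction s, hs using CliffordAlgebra.even_induction with
  | algebraMap r => rw [Algebra.algebraMap_eq_smul_one]; exact smul _ _ one_mem_sPlus one
  | add x y hx' hy' hx hy => exact add _ _ hx' hy' hx hy
  | ι_mul_ι_mul x y s hs ih =>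
    have := act x y s hs ih
    rw [vecAct_incl₁, vecAct_incl₁, ← mul_assoc] at this
    exact this

theorem vecAct_vecAct_mem (z w : W A n) (s : Ext A n) (hs : s ∈ SPlus A n) :
    vecAct A n z (vecAct A n w s) ∈ SPlus A n := by
  have h := vecAct_mem z _ _ (vecAct_mem w 0 _ hs)
  rwa [show (0 : ZMod 2) + 1 + 1 = 0 by decide] at h

/-- The universal property of `⋀ W₁` as a module over the Clifford algebra of `W`: it is generated
by a vector that is killed by `e_{n+1}, …, e_{2n}`. -/
theorem exists_fock {M : Type*} [AddCommGroup M] [Module A M] (T : W A n →ₗ[A] Module.End A M)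
    (hT : ∀ w s, T w (T w s) = Q A n w • s) (v : M) (hv : ∀ y, T (incl₂ A n y) v = 0) :
    ∃ F : Ext A n →ₗ[A] M, F 1 = v ∧ ∀ w s, F (vecAct A n w s) = T w (F s) := by
  let T₁ : (Fin n → A) →ₗ[A] M →ₗ[A] M := T ∘ₗ incl₁ A n
  have h0 : ∀ (m : Fin n → A) (s : M), T₁ m (T₁ m s) =
      (0 : QuadraticForm A (Fin n → A)) m • s := fun m s => by
    simpa [T₁, Q_incl₁] using hT (incl₁ A n m) s
  let F : Ext A n →ₗ[A] M := CliffordAlgebra.foldr _ T₁ h0 v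
  have h1 : F 1 = v := CliffordAlgebra.foldr_one _ _ _ _
  have h2 : ∀ x s, F (vecAct A n (incl₁ A n x) s) = T (incl₁ A n x) (F s) := fun x s => by
    rw [vecAct_incl₁]
    exact (CliffordAlgebra.foldr_mul _ _ _ _ _ _).trans (CliffordAlgebra.foldr_ι _ _ _ _ _)
  refine ⟨F, h1, fun w s => ?_⟩
  -- Annihilators need a separate argument because `F` is built from `W₁` alone. Both actions kill
  -- the generating vector and satisfy the same anticommutation relation with `W₁`, which determines
  -- them.
  have h3 : ∀ y s, F (vecAct A n (incl₂ A n y) s) = T (incl₂ A n y) (F s) := by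
    intro y s
    induction s using ext_induction with
    | one => rw [vecAct_incl₂_one, map_zero, h1, hv]
    | smul a s ih => simp only [map_smul, ih]
    | add s t hs ht => simp only [map_add, hs, ht]
    | act x s ih =>
      have e1 := congrArg F (vecAct_anticomm (incl₂ A n y) (incl₁ A n x) s)
      have e2 := anticomm_of_sq T hT (incl₂ A n y) (incl₁ A n x) (F s)
      rw [map_add, h2, ih, map_smul, ← e2] at e1
      rw [h2]
      exact add_right_cancel e1
  rw [← incl₁_add_incl₂ w]
  simp only [map_add, LinearMap.add_apply, h2, h3]

end Fock

/-! ### Products of basis vectors -/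

section Lists

variable {S : Type*} [Ring S]

theorem mul_prod_of_anticomm (l : List S) (a : S) (h : ∀ x ∈ l, a * x = -(x * a)) :
    a * l.prod = (-1) ^ l.length * (l.prod * a) := by
  induction l with
  | nil => simp
  | cons x l ih =>
    have ih' := ih fun y hy => h y (List.mem_cons_of_mem _ hy)
    rw [List.prod_cons, ← mul_assoc, h x List.mem_cons_self, neg_mul, mul_assoc, ih',
      List.length_cons, pow_succ]
    rcases neg_one_pow_eq_or S l.length with h | h <;> rw [h] <;> simp [mul_assoc]

theorem mul_prod_eq_zero (l : List S) (a : S) (ha : a ∈ l) (haa : a * a = 0)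
    (h : ∀ x ∈ l, a * x = -(x * a)) : a * l.prod = 0 := by
  induction l with
  | nil => simp at ha
  | cons x l ih =>
    rw [List.prod_cons, ← mul_assoc]
    rcases List.mem_cons.mp ha with rfl | ha'
    · rw [haa, zero_mul]
    · rw [h x List.mem_cons_self, neg_mul, mul_assoc,
        ih ha' fun y hy => h y (List.mem_cons_of_mem _ hy), mul_zero, neg_zero]

theorem prod_mul_eq_zero (l : List S) (a : S) (ha : a ∈ l) (haa : a * a = 0)
    (h : ∀ x ∈ l, a * x = -(x * a)) : l.prod * a = 0 := by
  have h1 := mul_prod_of_anticomm l a h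
  rw [mul_prod_eq_zero l a ha haa h] at h1
  rcases neg_one_pow_eq_or S l.length with h' | h' <;> rw [h'] at h1 <;> simpa using h1.symm

/-- Reversing a list of length `l` exchanges each of the `l.choose 2` pairs once, and each exchange
costs a sign. -/
theorem prod_reverse_of_anticomm (l : List S)
    (h : ∀ x ∈ l, ∀ y ∈ l, x * y = -(y * x)) :
    l.reverse.prod = ((-1 : ℤ) ^ (l.length.choose 2)) • l.prod := by
  induction l with
  | nil => simp
  | cons x l ih =>
    have ih' := ih fun y hy z hz =>
      h y (List.mem_cons_of_mem _ hy) z (List.mem_cons_of_mem _ hz)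
    have h1 := mul_prod_of_anticomm l x fun y hy =>
      h x List.mem_cons_self y (List.mem_cons_of_mem _ hy)
    rw [List.reverse_cons, List.prod_append, List.prod_singleton, ih', List.prod_cons, h1,
      List.length_cons, Nat.choose_succ_succ' _ 1, Nat.choose_one_right, pow_add]
    rcases Nat.even_or_odd l.length with h | h <;> rw [h.neg_one_pow, h.neg_one_pow] <;>
      simp [mul_assoc]

end Lists

/-! ### Creation and annihilation operators, the top vector, and endomorphisms of `S⁺`. -/

section Vacuum

variable {A : Type u} [CommRing A] {n : ℕ}

/-- The action of `e_i`. -/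
def cre (A : Type u) [CommRing A] (n : ℕ) (i : Fin n) : Module.End A (Ext A n) :=
  vecAct A n (incl₁ A n (Pi.single i 1))

/-- The action of `e_{n+i}`. -/
def ann (A : Type u) [CommRing A] (n : ℕ) (i : Fin n) : Module.End A (Ext A n) :=
  vecAct A n (incl₂ A n (Pi.single i 1))

theorem vecAct_incl₁_eq_sum (x : Fin n → A) :
    vecAct A n (incl₁ A n x) = ∑ i, x i • cre A n i := by
  conv_lhs => rw [pi_eq_sum_univ' x]
  simp only [map_sum, map_smul, cre]

theorem vecAct_incl₂_eq_sum (x : Fin n → A) :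
    vecAct A n (incl₂ A n x) = ∑ i, x i • ann A n i := by
  conv_lhs => rw [pi_eq_sum_univ' x]
  simp only [map_sum, map_smul, ann]

theorem vecAct_mul_comm (z w : W A n) (h : b z w = 0) :
    vecAct A n z * vecAct A n w = -(vecAct A n w * vecAct A n z) := by
  refine LinearMap.ext fun s => eq_neg_of_add_eq_zero_left ?_
  have := vecAct_anticomm z w s
  rwa [h, zero_smul] at this

theorem cre_mul_cre (i j : Fin n) : cre A n i * cre A n j = -(cre A n j * cre A n i) :=
  vecAct_mul_comm _ _ (by simp [b])

theorem ann_mul_ann (i j : Fin n) : ann A n i * ann A n j = -(ann A n j * ann A n i) :=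
  vecAct_mul_comm _ _ (by simp [b])

theorem cre_mul_self (i : Fin n) : cre A n i * cre A n i = 0 :=
  (vecAct_mul_self _).trans (by rw [Q_incl₁, map_zero])

theorem ann_mul_self (i : Fin n) : ann A n i * ann A n i = 0 :=
  (vecAct_mul_self _).trans (by rw [Q_incl₂, map_zero])

theorem ann_mul_cre_self (i : Fin n) : ann A n i * cre A n i = 1 - cre A n i * ann A n i := by
  refine LinearMap.ext fun s => eq_sub_of_add_eq ?_
  have h := vecAct_anticomm (incl₂ A n (Pi.single i 1)) (incl₁ A n (Pi.single i 1)) s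
  have hb : b (incl₂ A n (Pi.single i 1)) (incl₁ A n (Pi.single i 1)) = 1 := by
    simp [b, Pi.single_apply]
  rw [hb, one_smul] at h
  exact h

theorem ann_mul_cre_of_ne {i j : Fin n} (h : i ≠ j) :
    ann A n i * cre A n j = -(cre A n j * ann A n i) := by
  refine vecAct_mul_comm _ _ ?_
  simp only [b, incl₂_inl, incl₂_inr, incl₁_inl, incl₁_inr, zero_mul, zero_add]
  refine Finset.sum_eq_zero fun l _ => ?_
  by_cases hl : l = i
  · subst hl; simp [h]
  · simp [hl]

theorem ann_one (i : Fin n) : ann A n i 1 = 0 := vecAct_incl₂_one _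

/-- The element `e_1 ∧ … ∧ e_n`. -/
def vol (A : Type u) [CommRing A] (n : ℕ) : Ext A n :=
  ((List.finRange n).map (cre A n)).prod 1

/-- The coefficient of `e_1 ∧ … ∧ e_n`. -/
def top (A : Type u) [CommRing A] (n : ℕ) : Ext A n →ₗ[A] A :=
  ExteriorAlgebra.algebraMapInv.toLinearMap ∘ₗ ((List.finRange n).map (ann A n)).reverse.prod

theorem vecAct_incl₁_vol (x : Fin n → A) : vecAct A n (incl₁ A n x) (vol A n) = 0 := by
  rw [vecAct_incl₁_eq_sum, LinearMap.sum_apply]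
  refine Finset.sum_eq_zero fun i _ => ?_
  rw [LinearMap.smul_apply, vol, ← Module.End.mul_apply, mul_prod_eq_zero]
  · simp
  · exact List.mem_map_of_mem (List.mem_finRange i)
  · exact cre_mul_self i
  · intro y hy
    obtain ⟨j, -, rfl⟩ := List.mem_map.mp hy
    exact cre_mul_cre i j

theorem top_vecAct_incl₂ (x : Fin n → A) (s : Ext A n) :
    top A n (vecAct A n (incl₂ A n x) s) = 0 := by
  rw [vecAct_incl₂_eq_sum, LinearMap.sum_apply, map_sum]
  refine Finset.sum_eq_zero fun i _ => ?_
  rw [LinearMap.smul_apply, map_smul, top, LinearMap.comp_apply, ← Module.End.mul_apply,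
    prod_mul_eq_zero]
  · simp
  · exact List.mem_reverse.mpr (List.mem_map_of_mem (List.mem_finRange i))
  · exact ann_mul_self i
  · intro y hy
    obtain ⟨j, -, rfl⟩ := List.mem_map.mp (List.mem_reverse.mp hy)
    exact ann_mul_ann i j

theorem ann_prod_cre (l : List (Fin n)) (i : Fin n) (h : i ∉ l) :
    ann A n i ((l.map (cre A n)).prod 1) = 0 := by
  rw [← Module.End.mul_apply, mul_prod_of_anticomm]
  · simp [ann_one]
  · intro y hy
    obtain ⟨j, hj, rfl⟩ := List.mem_map.mp hy
    exact ann_mul_cre_of_ne fun hij => h (hij ▸ hj)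

theorem prod_reverse_ann_prod_cre (l : List (Fin n)) (h : l.Nodup) :
    (l.map (ann A n)).reverse.prod ((l.map (cre A n)).prod 1) = 1 := by
  induction l with
  | nil => simp
  | cons i l ih =>
    obtain ⟨hi, hl⟩ := List.nodup_cons.mp h
    rw [List.map_cons, List.map_cons, List.reverse_cons, List.prod_append, List.prod_singleton,
      List.prod_cons, Module.End.mul_apply, Module.End.mul_apply,
      ← Module.End.mul_apply (ann A n i), ann_mul_cre_self, LinearMap.sub_apply,
      Module.End.mul_apply, ann_prod_cre l i hi, map_zero, sub_zero]
    exact ih hl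

theorem top_vol : top A n (vol A n) = 1 := by
  rw [top, LinearMap.comp_apply, vol, prod_reverse_ann_prod_cre _ (List.nodup_finRange n)]
  exact map_one ExteriorAlgebra.algebraMapInv

/-- The order here is opposite to the one in `top`, which is the source of the sign; this product
appears when `swap` is applied to `vol`. -/
theorem prod_ann_vol :
    ((List.finRange n).map (ann A n)).prod (vol A n) = ((-1 : ℤ) ^ n.choose 2) • 1 := by
  have h := prod_reverse_of_anticomm ((List.finRange n).map (ann A n)) (by
    intro x hx y hy
    obtain ⟨i, -, rfl⟩ := List.mem_map.mp hx
    obtain ⟨j, -, rfl⟩ := List.mem_map.mp hy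
    exact ann_mul_ann i j)
  have h1 := prod_reverse_ann_prod_cre (A := A) _ (List.nodup_finRange n)
  rw [h, List.length_map, List.length_finRange] at h1
  rw [← h1, vol]
  rcases Nat.even_or_odd (n.choose 2) with h3 | h3 <;> simp [h3.neg_one_pow]

theorem prod_cre_mem_evenOdd (l : List (Fin n)) : (l.map (cre A n)).prod 1 ∈
    CliffordAlgebra.evenOdd (0 : QuadraticForm A (Fin n → A)) (l.length : ZMod 2) := by
  induction l with
  | nil => exact one_mem_sPlus
  | cons i l ih =>
    have := vecAct_mem (incl₁ A n (Pi.single i 1)) _ _ ih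
    rw [List.map_cons, List.prod_cons, List.length_cons, Nat.cast_add, Nat.cast_one]
    exact this

theorem vol_mem (hn : Even n) : vol A n ∈ SPlus A n := by
  have h := prod_cre_mem_evenOdd (A := A) (List.finRange n)
  rw [List.length_finRange, (ZMod.natCast_eq_zero_iff_even).mpr hn] at h
  exact h

/-- A vector that is killed by `e_{n+1}, …, e_{2n}` is a multiple of `1`. -/
theorem eq_smul_one_of_ann (s : Ext A n) (hs : ∀ i, ann A n i s = 0) : ∃ a : A, s = a • 1 := by
  -- The product of all `ann i * cre i` is a projector onto the multiples of `1`: each factor fixes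
  -- the vectors killed by `ann i`, and the product kills the image of every `cre j`. The factors
  -- with `i ≠ j` commute with `cre j`, so `cre j` can be moved next to its own factor.
  have hcomm : ∀ i j, i ≠ j → (ann A n i * cre A n i) * cre A n j =
      cre A n j * (ann A n i * cre A n i) := fun i j hij => by
    rw [mul_assoc, cre_mul_cre i j]
    refine LinearMap.ext fun s => ?_
    have h := LinearMap.congr_fun (ann_mul_cre_of_ne (A := A) hij) (cre A n i s)
    simp only [Module.End.mul_apply, LinearMap.neg_apply, map_neg] at h ⊢
    rw [h, neg_neg]
  have hkill : ∀ (l : List (Fin n)) (j : Fin n), j ∈ l →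
      (l.map fun i => ann A n i * cre A n i).prod * cre A n j = 0 := by
    intro l j
    induction l with
    | nil => simp
    | cons i l ih =>
      intro hj
      rw [List.map_cons, List.prod_cons, mul_assoc]
      by_cases hjl : j ∈ l
      · rw [ih hjl, mul_zero]
      · have hji : j = i := (List.mem_cons.mp hj).resolve_right hjl
        have hc : Commute (cre A n j) (l.map fun i => ann A n i * cre A n i).prod := by
          refine Commute.list_prod_right _ _ fun y hy => ?_
          obtain ⟨i', hi', rfl⟩ := List.mem_map.mp hy
          exact (hcomm i' j fun h => hjl (h ▸ hi')).symm
        rw [← hc.eq, ← hji, mul_assoc, ← mul_assoc (cre A n j), cre_mul_self, zero_mul, mul_zero]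
  have hfix : ∀ (l : List (Fin n)) (t : Ext A n), (∀ i, ann A n i t = 0) →
      (l.map fun i => ann A n i * cre A n i).prod t = t := by
    intro l t ht
    induction l with
    | nil => simp
    | cons i l ih =>
      rw [List.map_cons, List.prod_cons, Module.End.mul_apply, ih, ann_mul_cre_self,
        LinearMap.sub_apply, Module.End.mul_apply, ht, map_zero, sub_zero, Module.End.one_apply]
  have hall : ∀ t : Ext A n, ∃ a : A,
      ((List.finRange n).map fun i => ann A n i * cre A n i).prod t = a • 1 := by
    intro t
    induction t using ext_induction with
    | one => exact ⟨1, by rw [hfix _ _ ann_one, one_smul]⟩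
    | smul a t ih => obtain ⟨c, hc⟩ := ih; exact ⟨a * c, by rw [map_smul, hc, mul_smul]⟩
    | add s t hs ht =>
      obtain ⟨c, hc⟩ := hs; obtain ⟨d, hd⟩ := ht
      exact ⟨c + d, by rw [map_add, hc, hd, add_smul]⟩
    | act x t ih =>
      refine ⟨0, ?_⟩
      rw [vecAct_incl₁_eq_sum, LinearMap.sum_apply, map_sum, zero_smul]
      refine Finset.sum_eq_zero fun j _ => ?_
      rw [LinearMap.smul_apply, map_smul, ← Module.End.mul_apply,
        hkill _ _ (List.mem_finRange j), LinearMap.zero_apply, smul_zero]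
  obtain ⟨a, ha⟩ := hall s
  exact ⟨a, by rw [← ha, hfix _ _ hs]⟩

/-- An endomorphism of `S⁺` that commutes with the even part of the Clifford algebra is scalar. -/
theorem exists_smul_of_commute (y : SPlus A n →ₗ[A] Ext A n)
    (hy : ∀ (z w : W A n) (s : SPlus A n),
      y ⟨_, vecAct_vecAct_mem z w s s.2⟩ = vecAct A n z (vecAct A n w (y s))) :
    ∃ a : A, ∀ s, y s = a • (s : Ext A n) := by
  -- Only even products commute with `y`, so `ann j` cannot be used directly. Instead `cre j * ann
  -- j` kills `1`, hence kills `y 1`, and `ann j * cre j * ann j = ann j` recovers the vanishing of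
  -- `ann j` on `y 1`.
  have h1 : ∀ j, ann A n j (y ⟨1, one_mem_sPlus⟩) = 0 := by
    intro j
    have h := hy (incl₁ A n (Pi.single j 1)) (incl₂ A n (Pi.single j 1)) ⟨1, one_mem_sPlus⟩
    have h0 : y ⟨_, vecAct_vecAct_mem (incl₁ A n (Pi.single j 1)) (incl₂ A n (Pi.single j 1))
        (1 : Ext A n) one_mem_sPlus⟩ = 0 := by
      rw [← map_zero y]
      congr 1
      refine Subtype.ext ?_
      simp [vecAct_incl₂_one]
    have h2 : (cre A n j * ann A n j) (y ⟨1, one_mem_sPlus⟩) = 0 := h.symm.trans h0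
    have h3 : ann A n j * (cre A n j * ann A n j) = ann A n j := by
      rw [← mul_assoc, ann_mul_cre_self, sub_mul, mul_assoc, ann_mul_self, mul_zero, sub_zero,
        one_mul]
    rw [← h3, Module.End.mul_apply, h2, map_zero]
  obtain ⟨a, ha⟩ := eq_smul_one_of_ann _ h1
  refine ⟨a, ?_⟩
  rintro ⟨s, hs⟩
  suffices h : ∀ hs : s ∈ SPlus A n, y ⟨s, hs⟩ = a • s from h hs
  refine sPlus_induction (p := fun s => ∀ hs : s ∈ SPlus A n, y ⟨s, hs⟩ = a • s) (fun _ => ha) ?_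
    ?_ ?_ s hs
  · intro c s hs ih _
    rw [smul_comm, ← ih hs]
    exact map_smul y c ⟨s, hs⟩
  · intro s t hs ht ihs iht _
    rw [smul_add, ← ihs hs, ← iht ht]
    exact map_add y ⟨s, hs⟩ ⟨t, ht⟩
  · intro x z s hs ih _
    rw [← map_smul, ← map_smul, ← ih hs]
    exact hy _ _ ⟨s, hs⟩

end Vacuum

/-! ### Functoriality in the ring -/

section Functoriality

variable {A B C : Type u} [CommRing A] [CommRing B] [CommRing C] {n : ℕ}

theorem extMap_smul (f : A →+* B) (a : A) (s : Ext A n) :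
    extMap f n (a • s) = f a • extMap f n s := by
  simp only [Algebra.smul_def, map_mul, extMap_algebraMap]

theorem extMap_vecAct_incl₁ (f : A →+* B) (x : Fin n → A) (s : Ext A n) :
    extMap f n (vecAct A n (incl₁ A n x) s) =
      vecAct B n (incl₁ B n fun i => f (x i)) (extMap f n s) := by
  rw [vecAct_incl₁, vecAct_incl₁, map_mul, extMap_ι]

theorem map_b (f : A →+* B) (z w : W A n) :
    f (b z w) = b (fun i => f (z i)) (fun i => f (w i)) := by
  simp [b]

theorem map_incl₁ (f : A →+* B) (x : Fin n → A) :
    (fun j => f (incl₁ A n x j)) = incl₁ B n fun i => f (x i) := by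
  ext (i | i) <;> simp

theorem map_incl₂ (f : A →+* B) (x : Fin n → A) :
    (fun j => f (incl₂ A n x j)) = incl₂ B n fun i => f (x i) := by
  ext (i | i) <;> simp

/-- For `W₁` this is multiplicativity of `extMap`. The contractions follow by induction, since they
kill `1` and their anticommutation with `W₁` is compatible with `f`. -/
theorem extMap_vecAct (f : A →+* B) (w : W A n) (s : Ext A n) :
    extMap f n (vecAct A n w s) = vecAct B n (fun j => f (w j)) (extMap f n s) := by
  have h : ∀ (y : Fin n → A) (s : Ext A n), extMap f n (vecAct A n (incl₂ A n y) s) =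
      vecAct B n (incl₂ B n fun i => f (y i)) (extMap f n s) := by
    intro y s
    induction s using ext_induction with
    | one => rw [vecAct_incl₂_one, map_zero, map_one, vecAct_incl₂_one]
    | smul a s ih => rw [map_smul, extMap_smul, ih, extMap_smul, map_smul]
    | add s t hs ht => simp only [map_add, hs, ht]
    | act x s ih =>
      have e1 := congrArg (extMap f n) (vecAct_anticomm (incl₂ A n y) (incl₁ A n x) s)
      have e2 := vecAct_anticomm (incl₂ B n fun i => f (y i)) (incl₁ B n fun i => f (x i))
        (extMap f n s)
      rw [map_add, extMap_vecAct_incl₁, ih, extMap_smul, map_b, map_incl₁, map_incl₂, ← e2] at e1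
      rw [extMap_vecAct_incl₁]
      exact add_right_cancel e1
  have hw : (fun j => f (w j)) = incl₁ B n (fun i => f (w (Sum.inl i))) +
      incl₂ B n (fun i => f (w (Sum.inr i))) := (incl₁_add_incl₂ _).symm
  conv_lhs => rw [← incl₁_add_incl₂ w]
  rw [hw]
  simp only [map_add, LinearMap.add_apply, extMap_vecAct_incl₁, h]

theorem extMap_cre (f : A →+* B) (i : Fin n) (s : Ext A n) :
    extMap f n (cre A n i s) = cre B n i (extMap f n s) := by
  rw [cre, extMap_vecAct_incl₁, cre]
  congr 3
  ext j
  by_cases h : j = i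
  · subst h; simp
  · simp [h]

theorem extMap_vol (f : A →+* B) : extMap f n (vol A n) = vol B n := by
  suffices h : ∀ l : List (Fin n),
      extMap f n ((l.map (cre A n)).prod 1) = (l.map (cre B n)).prod 1 from h _
  intro l
  induction l with
  | nil => simp
  | cons i l ih =>
    rw [List.map_cons, List.prod_cons, Module.End.mul_apply, extMap_cre, ih, List.map_cons,
      List.prod_cons, Module.End.mul_apply]

theorem extMap_extMap (g : B →+* C) (f : A →+* B) (s : Ext A n) :
    extMap g n (extMap f n s) = extMap (g.comp f) n s := by
  induction s using ext_induction with
  | one => simp only [map_one]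
  | smul a s ih => simp only [extMap_smul, ih, RingHom.comp_apply]
  | add s t hs ht => simp only [map_add, hs, ht]
  | act x s ih => simp only [extMap_vecAct_incl₁, ih, RingHom.comp_apply]

theorem spinAct_ι_mul (w : W A n) (u : Cl A n) (s : Ext A n) :
    spinAct A n (CliffordAlgebra.ι (Q A n) w * u) s = vecAct A n w (spinAct A n u s) := by
  rw [map_mul, Module.End.mul_apply, spinAct, CliffordAlgebra.lift_ι_apply]

theorem spinAct_mul_ι (w : W A n) (u : Cl A n) (s : Ext A n) :
    spinAct A n (u * CliffordAlgebra.ι (Q A n) w) s = spinAct A n u (vecAct A n w s) := by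
  rw [map_mul, Module.End.mul_apply, spinAct, CliffordAlgebra.lift_ι_apply]

theorem spinAct_algebraMap (a : A) (s : Ext A n) :
    spinAct A n (algebraMap A _ a) s = a • s := by
  rw [AlgHom.commutes, Module.algebraMap_end_apply]

theorem extMap_spinAct (f : A →+* B) (u : Cl A n) (s : Ext A n) :
    extMap f n (spinAct A n u s) = spinAct B n (clMap f n u) (extMap f n s) := by
  induction u using CliffordAlgebra.left_induction with
  | algebraMap r => rw [spinAct_algebraMap, clMap_algebraMap, spinAct_algebraMap, extMap_smul]
  | add x y hx hy => simp only [map_add, LinearMap.add_apply, hx, hy]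
  | ι_mul x m hx => rw [spinAct_ι_mul, extMap_vecAct, hx, map_mul, clMap_ι, spinAct_ι_mul]

end Functoriality

/-! ### The invariant bilinear form -/

section Form

variable {A : Type u} [CommRing A] {n : ℕ}

/-- The dual of `⋀ W₁` is a Clifford module under transposed operators, and `top` is killed there by
`e_{n+1}, …, e_{2n}`. The universal property of the Fock space then sends `1` to `top`. -/
theorem exists_form : ∃ β : Ext A n →ₗ[A] Module.Dual A (Ext A n), β 1 = top A n ∧
    ∀ w s t, β (vecAct A n w s) t = β s (vecAct A n w t) := by
  let T : W A n →ₗ[A] Module.End A (Module.Dual A (Ext A n)) :=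
    LinearMap.mk₂ A (fun w d => d ∘ₗ vecAct A n w)
      (fun _ _ _ => by ext; simp) (fun _ _ _ => by ext; simp)
      (fun _ _ _ => by ext; simp) (fun _ _ _ => by ext; simp)
  obtain ⟨β, h1, h2⟩ := exists_fock T
    (fun w d => LinearMap.ext fun s => by simp [T, vecAct_vecAct]) (top A n)
    (fun y => LinearMap.ext fun s => top_vecAct_incl₂ y s)
  exact ⟨β, h1, fun w s t => LinearMap.congr_fun (h2 w s) t⟩

theorem form_spinAct {β : Ext A n →ₗ[A] Module.Dual A (Ext A n)}
    (hβ : ∀ w s t, β (vecAct A n w s) t = β s (vecAct A n w t)) (u : Cl A n) (s t : Ext A n) :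
    β (spinAct A n u s) t = β s (spinAct A n (CliffordAlgebra.reverse u) t) := by
  induction u using CliffordAlgebra.left_induction generalizing t with
  | algebraMap r =>
    simp only [CliffordAlgebra.reverse.commutes, spinAct_algebraMap, map_smul, LinearMap.smul_apply]
  | add x y hx hy => simp only [map_add, LinearMap.add_apply, hx, hy]
  | ι_mul x m hx =>
    rw [spinAct_ι_mul, hβ, hx, CliffordAlgebra.reverse.map_mul, CliffordAlgebra.reverse_ι,
      spinAct_mul_ι]

end Form

/-! ### The semilinear structure on `S⁺` -/

section Structure

variable {E₀ : Type u} [Field E₀] {A B : Type u} [CommRing A] [Algebra E₀ A] [CommRing B]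
  [Algebra E₀ B]

theorem coeff_mul_coeff (δ : E₀) (k n : ℕ) (i : Fin n) :
    coeff δ k n (Sum.inl i) * coeff δ k n (Sum.inr i) = -δ := by
  by_cases h : (i : ℕ) < k <;> simp [coeff, h]

/-- The linear map `T` with `ψ_{δ,k}(z, w) = b(z, T(σ w))`. -/
def tw (δ : E₀) (k n : ℕ) (A : Type u) [CommRing A] [Algebra E₀ A] : W A n →ₗ[A] W A n where
  toFun w j := algebraMap E₀ A (coeff δ k n j.swap) * w j.swap
  map_add' z w := by ext j; simp [mul_add]
  map_smul' c w := by ext j; simp [mul_left_comm]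

theorem tw_apply (δ : E₀) (k n : ℕ) (w : W A n) (j : Fin n ⊕ Fin n) :
    tw δ k n A w j = algebraMap E₀ A (coeff δ k n j.swap) * w j.swap := rfl

theorem Q_tw (δ : E₀) (k n : ℕ) (w : W A n) :
    Q A n (tw δ k n A w) = algebraMap E₀ A (-δ) * Q A n w := by
  rw [Q_apply, Q_apply, Finset.mul_sum]
  refine Finset.sum_congr rfl fun i _ => ?_
  rw [← coeff_mul_coeff δ k n i, map_mul, tw_apply, tw_apply, Sum.swap_inl, Sum.swap_inr]
  ring

theorem tw_tw (δ : E₀) (k n : ℕ) (w : W A n) :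
    tw δ k n A (tw δ k n A w) = algebraMap E₀ A (-δ) • w := by
  ext (i | i) <;>
  simp only [tw_apply, Sum.swap_inl, Sum.swap_inr, Pi.smul_apply, smul_eq_mul,
    ← coeff_mul_coeff δ k n i, map_mul] <;> ring

theorem map_tw (δ : E₀) (k n : ℕ) (f : A →ₐ[E₀] B) (w : W A n) :
    (fun j => f (tw δ k n A w j)) = tw δ k n B fun j => f (w j) := by
  ext j
  simp [tw_apply]

theorem tw_incl₁ (δ : E₀) (k n : ℕ) (i : Fin n) :
    tw δ k n A (incl₁ A n (Pi.single i 1)) =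
      algebraMap E₀ A (coeff δ k n (Sum.inl i)) • incl₂ A n (Pi.single i 1) := by
  ext (j | j)
  · simp [tw_apply]
  · by_cases h : j = i
    · subst h; simp [tw_apply]
    · simp [tw_apply, h]

theorem tw_incl₂ (δ : E₀) (k n : ℕ) (y : Fin n → A) : ∃ x, tw δ k n A (incl₂ A n y) = incl₁ A n x := by
  refine ⟨fun i => algebraMap E₀ A (coeff δ k n (Sum.inr i)) * y i, ?_⟩
  ext (j | j) <;> simp [tw_apply]

/-- Since `-δ` need not be a square, `T` cannot in general be rescaled to an isometry, so only
products of two vectors are intertwined. Two copies of `⋀ W₁` repair this: vectors act by exchanging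
the copies, with the factor `(-δ)⁻¹` on one of the two passages. -/
theorem exists_swap {δ : E₀} (hδ : δ ≠ 0) (k n : ℕ) (A : Type u) [CommRing A] [Algebra E₀ A] :
    ∃ J : Ext A n →ₗ[A] Ext A n, J 1 = vol A n ∧ ∀ z w s, J (vecAct A n z (vecAct A n w s)) =
      algebraMap E₀ A (-δ)⁻¹ • vecAct A n (tw δ k n A z) (vecAct A n (tw δ k n A w) (J s)) := by
  let T : W A n →ₗ[A] Module.End A (Ext A n × Ext A n) :=
    LinearMap.mk₂ A (fun w p => (algebraMap E₀ A (-δ)⁻¹ • vecAct A n (tw δ k n A w) p.2,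
      vecAct A n (tw δ k n A w) p.1))
      (fun _ _ _ => by simp)
      (fun c _ _ => Prod.ext (by simpa using smul_comm _ c _) (by simp))
      (fun _ _ _ => by simp)
      (fun c _ _ => Prod.ext (by simpa using smul_comm _ c _) (by simp))
  have hT : ∀ w p, T w p = (algebraMap E₀ A (-δ)⁻¹ • vecAct A n (tw δ k n A w) p.2,
      vecAct A n (tw δ k n A w) p.1) := fun _ _ => rfl
  obtain ⟨F, h1, h2⟩ := exists_fock T (fun w p => by
    rw [hT, hT]
    have h : algebraMap E₀ A (-δ)⁻¹ * (algebraMap E₀ A (-δ) * Q A n w) = Q A n w := by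
      rw [← mul_assoc, ← map_mul, inv_mul_cancel₀ (neg_ne_zero.mpr hδ), map_one, one_mul]
    ext1 <;> simp only [map_smul, vecAct_vecAct, Q_tw, smul_smul, h, Prod.smul_fst, Prod.smul_snd])
    -- `T` carries the span of `e_{n+1}, …, e_{2n}` into `W₁`, and wedging with `W₁` kills the top
    -- vector.
    (vol A n, 0) (fun y => by
      obtain ⟨x, hx⟩ := tw_incl₂ (A := A) δ k n y
      rw [hT, hx, vecAct_incl₁_vol, map_zero, smul_zero, Prod.mk_zero_zero])
  refine ⟨LinearMap.fst A _ _ ∘ₗ F, by rw [LinearMap.comp_apply, h1]; rfl, fun z w s => ?_⟩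
  rw [LinearMap.comp_apply, h2, h2, hT, hT]
  rfl

/-- A linear endomorphism of `⋀ W₁` that is compatible with the even similitude `T`. -/
def swap {δ : E₀} (hδ : δ ≠ 0) (k n : ℕ) (A : Type u) [CommRing A] [Algebra E₀ A] :
    Ext A n →ₗ[A] Ext A n := (exists_swap hδ k n A).choose

variable {δ : E₀} (hδ : δ ≠ 0) (k n : ℕ)

theorem swap_one : swap hδ k n A 1 = vol A n := (exists_swap hδ k n A).choose_spec.1

theorem swap_vecAct_vecAct (z w : W A n) (s : Ext A n) :
    swap hδ k n A (vecAct A n z (vecAct A n w s)) = algebraMap E₀ A (-δ)⁻¹ •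
      vecAct A n (tw δ k n A z) (vecAct A n (tw δ k n A w) (swap hδ k n A s)) :=
  (exists_swap hδ k n A).choose_spec.2 z w s

theorem swap_mem (hn : Even n) (s : Ext A n) (hs : s ∈ SPlus A n) :
    swap hδ k n A s ∈ SPlus A n := by
  refine sPlus_induction (p := fun s => swap hδ k n A s ∈ SPlus A n) ?_ ?_ ?_ ?_ s hs
  · rw [swap_one]; exact vol_mem hn
  · intro a s _ ih; rw [map_smul]; exact Submodule.smul_mem _ _ ih
  · intro s t _ _ ihs iht; rw [map_add]; exact Submodule.add_mem _ ihs iht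
  · intro x y s _ ih
    rw [swap_vecAct_vecAct]
    exact Submodule.smul_mem _ _ (vecAct_vecAct_mem _ _ _ ih)

theorem extMap_swap (f : A →ₐ[E₀] B) (s : Ext A n) (hs : s ∈ SPlus A n) :
    extMap f.toRingHom n (swap hδ k n A s) = swap hδ k n B (extMap f.toRingHom n s) := by
  refine sPlus_induction (p := fun s => extMap f.toRingHom n (swap hδ k n A s) =
    swap hδ k n B (extMap f.toRingHom n s)) ?_ ?_ ?_ ?_ s hs
  · rw [map_one (extMap _ _), swap_one, swap_one, extMap_vol]
  · intro a s _ ih; rw [map_smul, extMap_smul, ih, extMap_smul, map_smul]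
  · intro s t _ _ ihs iht; simp only [map_add, ihs, iht]
  · intro x y s _ ih
    have ht := map_tw δ k n f
    have hf : f.toRingHom (algebraMap E₀ A (-δ)⁻¹) = algebraMap E₀ B (-δ)⁻¹ := f.commutes _
    simp only [swap_vecAct_vecAct, extMap_vecAct, extMap_smul, ih, hf]
    erw [ht, ht]
    rfl

theorem vecAct_tw_incl₁ (i : Fin n) : vecAct A n (tw δ k n A (incl₁ A n (Pi.single i 1))) =
    algebraMap E₀ A (coeff δ k n (Sum.inl i)) • ann A n i := by
  rw [tw_incl₁, map_smul]
  rfl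

/-- Creators are peeled off two at a time. Each pair contributes one factor `(-δ)⁻¹`, and `T` turns
each `e_i` into its coefficient times `e_{n+i}`. -/
theorem swap_prod_cre (m : ℕ) (l : List (Fin n)) (hl : l.length = 2 * m) :
    swap hδ k n A ((l.map (cre A n)).prod 1) =
      algebraMap E₀ A ((-δ)⁻¹ ^ m * (l.map fun i => coeff δ k n (Sum.inl i)).prod) •
        (l.map (ann A n)).prod (vol A n) := by
  induction m generalizing l with
  | zero =>
    rw [mul_zero, List.length_eq_zero_iff] at hl
    subst hl
    simp [swap_one]
  | succ m ih =>
    match l, hl with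
    | i :: j :: l, hl =>
      have hl' : l.length = 2 * m := by simp only [List.length_cons] at hl; omega
      have h := swap_vecAct_vecAct (A := A) hδ k n (incl₁ A n (Pi.single i 1))
        (incl₁ A n (Pi.single j 1)) ((l.map (cre A n)).prod 1)
      rw [ih l hl', vecAct_tw_incl₁, vecAct_tw_incl₁] at h
      simp only [List.map_cons, List.prod_cons, Module.End.mul_apply]
      refine h.trans ?_
      simp only [map_smul, LinearMap.smul_apply, smul_smul, ← map_mul]
      congr 2
      ring

theorem prod_coeff (hk : k ≤ n) (δ : E₀) :
    ((List.finRange n).map fun i => coeff δ k n (Sum.inl i)).prod = δ ^ k := by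
  rw [← List.ofFn_eq_map, List.prod_ofFn]
  simp only [coeff, Sum.elim_inl]
  rw [Finset.prod_ite, Finset.prod_const, Finset.prod_const_one, mul_one]
  congr 1
  rw [Fin.card_filter_val_lt, min_eq_right hk]

/-- This scalar decides whether an `E₀`-structure can be obtained by rescaling with an element of
`E₀`. The sign from `prod_ann_vol` cancels the sign of `(-δ)⁻¹ ^ m`, and the first `k` coefficients
contribute `δ ^ k`. -/
theorem swap_swap_one (m : ℕ) (hn : n = 2 * m) (hk : k ≤ n) :
    swap hδ k n A (swap hδ k n A 1) = algebraMap E₀ A (δ⁻¹ ^ m * δ ^ k) • 1 := by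
  have h := swap_prod_cre (A := A) hδ k n m (List.finRange n) (by rw [List.length_finRange, hn])
  rw [prod_ann_vol, prod_coeff k n hk] at h
  rw [swap_one]
  refine h.trans ?_
  -- For `n = 2m` the binomial coefficient is `m(2m - 1)`, which has the parity of `m`.
  have hc : (-1 : ℤ) ^ n.choose 2 = (-1) ^ m := by
    subst hn
    rw [Nat.choose_two_right, mul_assoc, Nat.mul_div_cancel_left _ two_pos]
    cases m with
    | zero => simp
    | succ m =>
      rw [show (m + 1) * (2 * (m + 1) - 1) = (m + 1) + 2 * (m * (m + 1)) by
        rw [show 2 * (m + 1) - 1 = 2 * m + 1 by omega]; ring, pow_add, pow_mul]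
      simp
  rw [hc, ← neg_inv, neg_pow]
  rcases Nat.even_or_odd m with hm | hm <;> simp [hm.neg_one_pow]

end Structure

/-! ### Elements of the spin group and the semilinear structure -/

section Semilinear

variable {E₀ : Type u} [Field E₀] {A B : Type u} [CommRing A] [Algebra E₀ A] [CommRing B]
  [Algebra E₀ B] {δ : E₀} (hδ : δ ≠ 0) (k n : ℕ) (c : E₀) (τ : A →ₐ[E₀] A)

/-- The semilinear endomorphism of `⋀ W₁` given by `swap`, normalised by a constant `c`. -/
def semi : Ext A n →+ Ext A n where
  toFun s := algebraMap E₀ A c • swap hδ k n A (extMap τ.toRingHom n s)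
  map_zero' := by simp
  map_add' s t := by simp

theorem semi_apply (s : Ext A n) : semi hδ k n c τ s =
    algebraMap E₀ A c • swap hδ k n A (extMap τ.toRingHom n s) := rfl

variable {n}

theorem semi_smul (a : A) (s : Ext A n) :
    semi hδ k n c τ (a • s) = τ a • semi hδ k n c τ s := by
  rw [semi_apply, semi_apply, extMap_smul, map_smul, smul_comm]
  rfl

theorem semi_mem (hn : Even n) (s : Ext A n) (hs : s ∈ SPlus A n) :
    semi hδ k n c τ s ∈ SPlus A n :=
  Submodule.smul_mem _ _ (swap_mem hδ k n hn _ (extMap_mem _ _ _ hs))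

theorem semi_vecAct_vecAct (z w : W A n) (s : Ext A n) :
    semi hδ k n c τ (vecAct A n z (vecAct A n w s)) = algebraMap E₀ A (-δ)⁻¹ •
      vecAct A n (tw δ k n A fun j => τ (z j)) (vecAct A n (tw δ k n A fun j => τ (w j))
        (semi hδ k n c τ s)) := by
  rw [semi_apply, extMap_vecAct, extMap_vecAct, swap_vecAct_vecAct, smul_comm,
    semi_apply _ _ _ _ _ s]
  simp only [map_smul]
  rfl

theorem extMap_semi (τ' : B →ₐ[E₀] B) (f : A →ₐ[E₀] B) (hf : ∀ a, f (τ a) = τ' (f a))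
    (s : Ext A n) (hs : s ∈ SPlus A n) :
    extMap f.toRingHom n (semi hδ k n c τ s) = semi hδ k n c τ' (extMap f.toRingHom n s) := by
  have h : f.toRingHom.comp τ.toRingHom = τ'.toRingHom.comp f.toRingHom := RingHom.ext hf
  have hc : f.toRingHom (algebraMap E₀ A c) = algebraMap E₀ B c := f.commutes c
  rw [semi_apply, extMap_smul, extMap_swap _ _ _ _ _ (extMap_mem _ _ _ hs), extMap_extMap, h, hc,
    ← extMap_extMap, semi_apply]

variable {k c}

theorem tw_tau_tw_tau (hτ : ∀ a, τ (τ a) = a) (w : W A n) :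
    (tw δ k n A fun j => τ (tw δ k n A (fun j => τ (w j)) j)) = algebraMap E₀ A (-δ) • w := by
  rw [map_tw]
  simp only [hτ]
  exact tw_tw δ k n w

theorem smul_vecAct_neg_smul (hδ : δ ≠ 0) (z w : W A n) (s : Ext A n) :
    algebraMap E₀ A (-δ)⁻¹ • algebraMap E₀ A (-δ)⁻¹ • vecAct A n (algebraMap E₀ A (-δ) • z)
      (vecAct A n (algebraMap E₀ A (-δ) • w) s) = vecAct A n z (vecAct A n w s) := by
  have h : (-δ)⁻¹ * ((-δ)⁻¹ * (-δ * -δ)) = 1 := by field_simp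
  simp only [map_smul, LinearMap.smul_apply, smul_smul, ← map_mul]
  rw [h, map_one, one_smul]

theorem semi_semi_vecAct_vecAct (hτ : ∀ a, τ (τ a) = a) (z w : W A n) (s : Ext A n) :
    semi hδ k n c τ (semi hδ k n c τ (vecAct A n z (vecAct A n w s))) =
      vecAct A n z (vecAct A n w (semi hδ k n c τ (semi hδ k n c τ s))) := by
  rw [semi_vecAct_vecAct, semi_smul, semi_vecAct_vecAct, tw_tau_tw_tau τ hτ,
    tw_tau_tw_tau τ hτ, AlgHom.commutes, smul_vecAct_neg_smul hδ]

/-- The square of the semilinear map is linear and commutes with products of two vectors, so its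
value at `1` propagates to all of `S⁺`; `hc` normalises that value. -/
theorem semi_semi {m : ℕ} (hτ : ∀ a, τ (τ a) = a) (hn : n = 2 * m) (hk : k ≤ n)
    (hc : c * c * (δ⁻¹ ^ m * δ ^ k) = 1) (s : Ext A n) (hs : s ∈ SPlus A n) :
    semi hδ k n c τ (semi hδ k n c τ s) = s := by
  refine sPlus_induction (p := fun s => semi hδ k n c τ (semi hδ k n c τ s) = s) ?_ ?_ ?_ ?_ s hs
  · have h1 : semi hδ k n c τ (1 : Ext A n) = algebraMap E₀ A c • swap hδ k n A 1 := by
      rw [semi_apply, map_one (extMap _ _)]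
    rw [h1, semi_smul, AlgHom.commutes, semi_apply,
      extMap_swap _ _ _ _ _ one_mem_sPlus, map_one (extMap _ _), swap_swap_one hδ k n m hn hk,
      smul_smul, smul_smul, ← map_mul, ← map_mul, hc, map_one, one_smul]
  · intro a s _ ih; rw [semi_smul, semi_smul, ih, hτ]
  · intro s t _ _ ihs iht; rw [map_add, map_add, ihs, iht]
  · intro x y s _ ih
    rw [semi_semi_vecAct_vecAct hδ τ hτ, ih]

theorem spinAct_inv_spinAct (u : (Cl A n)ˣ) (s : Ext A n) :
    spinAct A n ((u⁻¹ : (Cl A n)ˣ) : Cl A n) (spinAct A n (u : Cl A n) s) = s := by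
  rw [← Module.End.mul_apply, ← map_mul, Units.inv_mul, map_one, Module.End.one_apply]

theorem spinAct_spinAct_inv (u : (Cl A n)ˣ) (s : Ext A n) :
    spinAct A n (u : Cl A n) (spinAct A n ((u⁻¹ : (Cl A n)ˣ) : Cl A n) s) = s := by
  rw [← Module.End.mul_apply, ← map_mul, Units.mul_inv, map_one, Module.End.one_apply]

theorem smul_one_injective {a a' : A} (h : a • (1 : Ext A n) = a' • 1) : a = a' := by
  rw [← Algebra.algebraMap_eq_smul_one, ← Algebra.algebraMap_eq_smul_one] at h
  exact (ExteriorAlgebra.algebraMap_leftInverse (R := A) (Fin n → A)).injective h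

/-- An element of the spin group whose action on `W` commutes with `T ∘ τ` commutes with the
semilinear structure on `S⁺` up to a scalar. -/
theorem exists_smul_of_conj {m : ℕ} (hτ : ∀ a, τ (τ a) = a) (hn : n = 2 * m) (hk : k ≤ n)
    (hc : c * c * (δ⁻¹ ^ m * δ ^ k) = 1) (u : (Cl A n)ˣ) (g : W A n →ₗ[A] W A n)
    (hu : ∀ w, (u : Cl A n) * CliffordAlgebra.ι (Q A n) w * ((u⁻¹ : (Cl A n)ˣ) : Cl A n) =
      CliffordAlgebra.ι (Q A n) (g w))
    (hg : ∀ w, (tw δ k n A fun j => τ (g w j)) = g (tw δ k n A fun j => τ (w j))) :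
    ∃ a : A, ∀ s ∈ SPlus A n,
      semi hδ k n c τ (spinAct A n u s) = a • spinAct A n u (semi hδ k n c τ s) := by
  have hev : Even n := ⟨m, by rw [hn, two_mul]⟩
  have h1 : ∀ w s, spinAct A n u (vecAct A n w s) = vecAct A n (g w) (spinAct A n u s) := by
    intro w s
    rw [← spinAct_mul_ι, ← spinAct_ι_mul, ← hu, Units.inv_mul_cancel_right]
  have h2 : ∀ w s, spinAct A n ((u⁻¹ : (Cl A n)ˣ) : Cl A n) (vecAct A n (g w) s) =
      vecAct A n w (spinAct A n ((u⁻¹ : (Cl A n)ˣ) : Cl A n) s) := by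
    intro w s
    rw [← spinAct_mul_ι, ← spinAct_ι_mul, ← hu, ← mul_assoc, Units.inv_mul_cancel_left]
  -- The operator `u⁻¹JuJ` is linear because it contains two semilinear factors. Commutation of `g`
  -- with `Tτ` makes it commute with even products, hence scalar; evaluation at `J s`, together with
  -- `J² = 1`, gives the claim.
  let y : SPlus A n →ₗ[A] Ext A n :=
    { toFun := fun s => spinAct A n ((u⁻¹ : (Cl A n)ˣ) : Cl A n)
        (semi hδ k n c τ (spinAct A n u (semi hδ k n c τ (s : Ext A n))))
      map_add' := fun s t => by simp only [Submodule.coe_add, map_add]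
      map_smul' := fun a s => by
        simp only [Submodule.coe_smul, semi_smul, map_smul, hτ, RingHom.id_apply] }
  obtain ⟨a, ha⟩ := exists_smul_of_commute y (fun z w s => by
    change spinAct A n ((u⁻¹ : (Cl A n)ˣ) : Cl A n) (semi hδ k n c τ (spinAct A n u
      (semi hδ k n c τ (vecAct A n z (vecAct A n w s))))) = _
    rw [semi_vecAct_vecAct, map_smul, h1, h1, semi_smul, AlgHom.commutes, semi_vecAct_vecAct, hg,
      hg, tw_tau_tw_tau τ hτ, tw_tau_tw_tau τ hτ, map_smul g, map_smul g,
      smul_vecAct_neg_smul hδ, h2, h2]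
    rfl)
  refine ⟨a, fun s hs => ?_⟩
  have h := ha ⟨_, semi_mem hδ k c τ hev s hs⟩
  rw [← map_smul, ← h]
  change _ = spinAct A n u (spinAct A n ((u⁻¹ : (Cl A n)ˣ) : Cl A n) (semi hδ k n c τ
    (spinAct A n u (semi hδ k n c τ (semi hδ k n c τ s)))))
  rw [spinAct_spinAct_inv, semi_semi hδ τ hτ hn hk hc s hs]

/-- A second application of `J` to the relation `Ju = a uJ` gives `u = τ(a) a u` on `1`, and `u` is
invertible. -/
theorem tau_mul_self_of_semi {m : ℕ} (hτ : ∀ a, τ (τ a) = a) (hn : n = 2 * m) (hk : k ≤ n)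
    (hc : c * c * (δ⁻¹ ^ m * δ ^ k) = 1) (u : (Cl A n)ˣ)
    (hu0 : (u : Cl A n) ∈ CliffordAlgebra.even (Q A n)) (a : A)
    (ha : ∀ s ∈ SPlus A n,
      semi hδ k n c τ (spinAct A n u s) = a • spinAct A n u (semi hδ k n c τ s)) :
    τ a * a = 1 := by
  have hev : Even n := ⟨m, by rw [hn, two_mul]⟩
  have h := congrArg (semi hδ k n c τ) (ha 1 one_mem_sPlus)
  rw [semi_semi hδ τ hτ hn hk hc _ (spinAct_mem _ hu0 _ one_mem_sPlus), semi_smul,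
    ha _ (semi_mem hδ k c τ hev _ one_mem_sPlus),
    semi_semi hδ τ hτ hn hk hc _ one_mem_sPlus, smul_smul] at h
  have h' := congrArg (spinAct A n ((u⁻¹ : (Cl A n)ˣ) : Cl A n)) h
  rw [map_smul, spinAct_inv_spinAct] at h'
  exact (smul_one_injective ((one_smul A (1 : Ext A n)).trans h')).symm

/-- The vector `uJ1` has no annihilator: `u⁻¹` followed by `J` carries it back to `1`, at the cost
of applying `τ` to the scalar. -/
theorem eq_of_smul_spinAct_semi {m : ℕ} (hτ : ∀ a, τ (τ a) = a) (hn : n = 2 * m) (hk : k ≤ n)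
    (hc : c * c * (δ⁻¹ ^ m * δ ^ k) = 1) (u : (Cl A n)ˣ) {a a' : A}
    (h : a • spinAct A n u (semi hδ k n c τ 1) = a' • spinAct A n u (semi hδ k n c τ 1)) :
    a = a' := by
  rw [← map_smul (spinAct A n (u : Cl A n)), ← map_smul (spinAct A n (u : Cl A n))] at h
  have h1 := congrArg (spinAct A n ((u⁻¹ : (Cl A n)ˣ) : Cl A n)) h
  rw [spinAct_inv_spinAct, spinAct_inv_spinAct] at h1
  have h2 := congrArg (semi hδ k n c τ) h1
  rw [semi_smul, semi_smul, semi_semi hδ τ hτ hn hk hc _ one_mem_sPlus] at h2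
  rw [← hτ a, smul_one_injective h2, hτ]

/-- Here `v` is the transform of `u` under `zw ↦ (-δ)⁻¹ (Tτz)(Tτw)`. Building `v` by induction
together with its reversal avoids constructing this map and proving that it commutes with `reverse`.
-/
theorem exists_intertwine (u : Cl A n) (hu : u ∈ CliffordAlgebra.even (Q A n)) :
    ∃ v : Cl A n, ∀ s,
      semi hδ k n c τ (spinAct A n u s) = spinAct A n v (semi hδ k n c τ s) ∧
      semi hδ k n c τ (spinAct A n (CliffordAlgebra.reverse u) s) =
        spinAct A n (CliffordAlgebra.reverse v) (semi hδ k n c τ s) := by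
  have hu' : u ∈ CliffordAlgebra.evenOdd (Q A n) 0 := hu
  clear hu
  induction u, hu' using CliffordAlgebra.even_induction with
  | algebraMap r =>
    refine ⟨algebraMap A _ (τ r), fun s => ?_⟩
    simp only [CliffordAlgebra.reverse.commutes, spinAct_algebraMap, semi_smul, and_self]
  | add x y _ _ hx hy =>
    obtain ⟨v, hv⟩ := hx
    obtain ⟨w, hw⟩ := hy
    refine ⟨v + w, fun s => ?_⟩
    simp only [map_add, LinearMap.add_apply, (hv s).1, (hv s).2, (hw s).1, (hw s).2, and_self]
  | ι_mul_ι_mul z w x _ hx =>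
    obtain ⟨v, hv⟩ := hx
    refine ⟨algebraMap E₀ A (-δ)⁻¹ • (CliffordAlgebra.ι (Q A n) (tw δ k n A fun j => τ (z j)) *
      (CliffordAlgebra.ι (Q A n) (tw δ k n A fun j => τ (w j)) * v)), fun s => ⟨?_, ?_⟩⟩
    · rw [mul_assoc, spinAct_ι_mul, spinAct_ι_mul, semi_vecAct_vecAct, (hv s).1, map_smul,
        LinearMap.smul_apply, spinAct_ι_mul, spinAct_ι_mul]
    · simp only [CliffordAlgebra.reverse.map_mul, CliffordAlgebra.reverse_ι, map_smul]
      rw [← mul_assoc, spinAct_mul_ι, spinAct_mul_ι, (hv _).2, semi_vecAct_vecAct, map_smul,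
        LinearMap.smul_apply, spinAct_mul_ι, spinAct_mul_ι]

/-- On `S⁺` the transform `v` of `u` equals `a u`. Both `u` and `v` preserve the pairing of `1` with
the top vector, which is `1`; comparing the two gives `a² = 1`. -/
theorem mul_self_of_semi {m : ℕ} (hτ : ∀ a, τ (τ a) = a) (hn : n = 2 * m) (hk : k ≤ n)
    (hc : c * c * (δ⁻¹ ^ m * δ ^ k) = 1) (u : Cl A n)
    (hu0 : u ∈ CliffordAlgebra.even (Q A n)) (hu1 : CliffordAlgebra.reverse u * u = 1) (a : A)
    (ha : ∀ s ∈ SPlus A n,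
      semi hδ k n c τ (spinAct A n u s) = a • spinAct A n u (semi hδ k n c τ s)) :
    a * a = 1 := by
  have hev : Even n := ⟨m, by rw [hn, two_mul]⟩
  obtain ⟨v, hv⟩ := exists_intertwine (k := k) (c := c) hδ τ u hu0
  obtain ⟨β, hβ1, hβ2⟩ := exists_form (A := A) (n := n)
  have h1 : ∀ s ∈ SPlus A n, spinAct A n v s = a • spinAct A n u s := by
    intro s hs
    have h := (hv (semi hδ k n c τ s)).1
    rw [ha _ (semi_mem hδ k c τ hev s hs), semi_semi hδ τ hτ hn hk hc s hs] at h
    exact h.symm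
  have h2 : ∀ s, spinAct A n (CliffordAlgebra.reverse u) (spinAct A n u s) = s := fun s => by
    rw [← Module.End.mul_apply, ← map_mul, hu1, map_one, Module.End.one_apply]
  have h3 : ∀ s ∈ SPlus A n,
      spinAct A n (CliffordAlgebra.reverse v) (spinAct A n v s) = s := by
    intro s hs
    have h := (hv (spinAct A n u (semi hδ k n c τ s))).2
    rw [h2, (hv _).1, semi_semi hδ τ hτ hn hk hc s hs] at h
    exact h.symm
  have h4 : β (spinAct A n v 1) (spinAct A n v (vol A n)) = 1 := by
    rw [form_spinAct hβ2, h3 _ (vol_mem hev), hβ1, top_vol]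
  rw [h1 _ one_mem_sPlus, h1 _ (vol_mem hev), map_smul, map_smul, LinearMap.smul_apply,
    form_spinAct hβ2, h2, hβ1, top_vol, smul_eq_mul, smul_eq_mul, mul_one] at h4
  exact h4

end Semilinear

/-! ### The semilinear structure is preserved by the spin double cover -/

section Conjugation

variable {E₀ E : Type u} [Field E₀] [Field E] [Algebra E₀ E] (σ : E ≃ₐ[E₀] E)
  (R : Type u) [CommRing R] [Algebra E₀ R]

/-- The conjugation of `R ⊗ E` as a homomorphism of `E₀`-algebras. -/
def conj₀ : R ⊗[E₀] E →ₐ[E₀] R ⊗[E₀] E := (conj σ R).restrictScalars E₀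

theorem conj₀_tmul (r : R) (x : E) : conj₀ σ R (r ⊗ₜ x) = r ⊗ₜ σ x := rfl

variable {σ}

theorem conj₀_conj₀ (hσ : ∀ x, σ (σ x) = x) (a : R ⊗[E₀] E) :
    conj₀ σ R (conj₀ σ R a) = a := by
  induction a with
  | zero => simp
  | add x y hx hy => rw [map_add, map_add, hx, hy]
  | tmul r x => rw [conj₀_tmul, conj₀_tmul, hσ]

/-- In the form `r ⊗ 1 + r' ⊗ θ`, conjugation changes the sign of the second term, so invariance
kills twice that term. -/
theorem exists_tmul_one_of_conj₀ (h2 : (2 : E₀) ≠ 0) {θ : E} (hθ : σ θ = -θ)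
    (hspan : ∀ x : E, ∃ p q : E₀, x = algebraMap E₀ E p + q • θ) (a : R ⊗[E₀] E)
    (ha : conj₀ σ R a = a) : ∃ r : R, a = r ⊗ₜ 1 := by
  have hall : ∀ a : R ⊗[E₀] E, ∃ r r' : R, a = r ⊗ₜ 1 + r' ⊗ₜ θ := by
    intro a
    induction a with
    | zero => exact ⟨0, 0, by simp⟩
    | add x y hx hy =>
      obtain ⟨r, r', rfl⟩ := hx
      obtain ⟨s, s', rfl⟩ := hy
      exact ⟨r + s, r' + s', by rw [TensorProduct.add_tmul, TensorProduct.add_tmul]; abel⟩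
    | tmul r x =>
      obtain ⟨p, q, rfl⟩ := hspan x
      refine ⟨p • r, q • r, ?_⟩
      rw [TensorProduct.tmul_add, Algebra.algebraMap_eq_smul_one, TensorProduct.smul_tmul,
        TensorProduct.smul_tmul]
  obtain ⟨r, r', rfl⟩ := hall a
  refine ⟨r, ?_⟩
  rw [map_add, conj₀_tmul, conj₀_tmul, map_one, hθ, TensorProduct.tmul_neg] at ha
  have h : (2 : E₀) • (r' ⊗ₜ[E₀] θ : R ⊗[E₀] E) = 0 := by
    have := add_left_cancel ha
    rw [two_smul]
    nth_rewrite 1 [← this]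
    exact neg_add_cancel _
  rw [(smul_eq_zero_iff_right h2).mp h, add_zero]

theorem map_conj₀ {R' : Type u} [CommRing R'] [Algebra E₀ R'] (f : R →ₐ[E₀] R')
    (a : R ⊗[E₀] E) :
    Algebra.TensorProduct.map f (AlgHom.id E₀ E) (conj₀ σ R a) =
      conj₀ σ R' (Algebra.TensorProduct.map f (AlgHom.id E₀ E) a) := by
  induction a with
  | zero => simp
  | add x y hx hy => simp only [map_add, hx, hy]
  | tmul r x => rfl

theorem psi_eq_b {δ : E₀} {k n : ℕ} (z w : W (R ⊗[E₀] E) n) :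
    psi σ δ k n R z w = b z (tw δ k n (R ⊗[E₀] E) fun j => conj₀ σ R (w j)) := by
  rw [psi, b, Fintype.sum_sum_type, ← Finset.sum_add_distrib]
  refine Finset.sum_congr rfl fun i _ => ?_
  simp only [tw_apply, Sum.swap_inl, Sum.swap_inr]
  change algebraMap E₀ (R ⊗[E₀] E) _ * z (Sum.inl i) * conj₀ σ R (w (Sum.inl i)) +
    algebraMap E₀ (R ⊗[E₀] E) _ * z (Sum.inr i) * conj₀ σ R (w (Sum.inr i)) = _
  ring

theorem b_sub_right {A : Type u} [CommRing A] {n : ℕ} (z w w' : W A n) :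
    b z (w - w') = b z w - b z w' := by
  simp only [b, Pi.sub_apply, ← Finset.sum_sub_distrib]
  exact Finset.sum_congr rfl fun i _ => by ring

theorem eq_of_b_eq {A : Type u} [CommRing A] {n : ℕ} {w w' : W A n}
    (h : ∀ z, b z w = b z w') : w = w' := by
  rw [← sub_eq_zero]
  have h' : ∀ z, b z (w - w') = 0 := fun z => by rw [b_sub_right, h, sub_self]
  ext (i | i)
  · simpa [b, Pi.single_apply] using h' (Pi.single (Sum.inr i) 1)
  · simpa [b, Pi.single_apply] using h' (Pi.single (Sum.inl i) 1)

/-- Both sides have the same pairing under `b` with every `g z`: one pairing is `ψ(gz, gw)`, the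
other is `ψ(z, w)`. -/
theorem tw_conj₀_of_mem_G {δ : E₀} {k n : ℕ}
    {g : W (R ⊗[E₀] E) n ≃ₗ[R ⊗[E₀] E] W (R ⊗[E₀] E) n} (hg : g ∈ G σ δ k n R)
    (w : W (R ⊗[E₀] E) n) :
    (tw δ k n (R ⊗[E₀] E) fun j => conj₀ σ R (g w j)) =
      g (tw δ k n (R ⊗[E₀] E) fun j => conj₀ σ R (w j)) := by
  refine eq_of_b_eq fun z => ?_
  obtain ⟨z, rfl⟩ := g.surjective z
  rw [hg.2.1, ← psi_eq_b, hg.2.2, psi_eq_b]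

/-! ### The sign character of the preimage, and its triviality on the neutral component. -/

section Spin

variable {δ : E₀} (hδ : δ ≠ 0) {k n m : ℕ} {c : E₀}

theorem reverse_mul_of_mem_Spin {A : Type u} [CommRing A] {u : (Cl A n)ˣ} (hu : u ∈ Spin A n) :
    CliffordAlgebra.reverse (u : Cl A n) * (u : Cl A n) = 1 := by
  have h := hu.2.1.1
  rwa [CliffordAlgebra.star_def, CliffordAlgebra.involute_eq_of_mem_even hu.1] at h

theorem exists_sign_of_mem_preG (hσ : ∀ x, σ (σ x) = x) (h2 : (2 : E₀) ≠ 0) {θ : E}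
    (hθ : σ θ = -θ) (hspan : ∀ x : E, ∃ p q : E₀, x = algebraMap E₀ E p + q • θ)
    (hn : n = 2 * m) (hk : k ≤ n) (hc : c * c * (δ⁻¹ ^ m * δ ^ k) = 1)
    {u : (Cl (R ⊗[E₀] E) n)ˣ} (hu : u ∈ preG σ δ k n R) :
    ∃ r : R, r * r = 1 ∧ ∀ s ∈ SPlus (R ⊗[E₀] E) n,
      semi hδ k n c (conj₀ σ R) (spinAct _ n u s) =
        (r ⊗ₜ[E₀] (1 : E) : R ⊗[E₀] E) • spinAct _ n u (semi hδ k n c (conj₀ σ R) s) := by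
  have hτ := conj₀_conj₀ R hσ
  obtain ⟨hu1, g, hg, hug⟩ := hu
  obtain ⟨a, ha⟩ := exists_smul_of_conj hδ (conj₀ σ R) hτ hn hk hc u g.toLinearMap hug
    (tw_conj₀_of_mem_G R hg)
  have haa := mul_self_of_semi hδ (conj₀ σ R) hτ hn hk hc _ hu1.1 (reverse_mul_of_mem_Spin hu1) a ha
  have hta := tau_mul_self_of_semi hδ (conj₀ σ R) hτ hn hk hc u hu1.1 a ha
  -- From `τ(a) a = 1 = a²` it follows that `τ(a) = a`, so the scalar descends to `R`.
  have hfix : conj₀ σ R a = a := by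
    calc conj₀ σ R a = conj₀ σ R a * a * a := by rw [mul_assoc, haa, mul_one]
      _ = a := by rw [hta, one_mul]
  obtain ⟨r, rfl⟩ := exists_tmul_one_of_conj₀ R h2 hθ hspan a hfix
  refine ⟨r, ?_, ha⟩
  rw [Algebra.TensorProduct.tmul_mul_tmul, mul_one, Algebra.TensorProduct.one_def] at haa
  exact Algebra.TensorProduct.includeLeft_injective (S := R) (algebraMap E₀ E).injective haa

theorem isClosed_zariski {K M N : Type u} [Field K] [AddCommGroup M] [Module K M]
    [AddCommGroup N] [Module K N] (L : M →ₗ[K] N) : @IsClosed M (zariski K M) {x | L x = 0} := by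
  let _ := zariski K M
  have h : {x | L x = 0} = ⋂ d : Module.Dual K N, {x | (d ∘ₗ L) x ≠ 0}ᶜ := by
    ext x
    simp [Module.forall_dual_apply_eq_zero_iff]
  rw [h]
  refine isClosed_iInter fun d => IsOpen.isClosed_compl ?_
  exact TopologicalSpace.isOpen_generateFrom_of_mem
    ⟨_, Algebra.subset_adjoin ⟨d ∘ₗ L, rfl⟩, rfl⟩

/-- For fixed `r` the condition `Ju = r uJ` is `K`-linear in `u`, hence Zariski closed. The loci for
`r = 1` and `r = -1` cover the neutral component and do not meet on it, and the first contains the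
identity. -/
theorem semi_comm_of_mem_neutral (hσ : ∀ x, σ (σ x) = x) (h2 : (2 : E₀) ≠ 0) {θ : E}
    (hθ : σ θ = -θ) (hspan : ∀ x : E, ∃ p q : E₀, x = algebraMap E₀ E p + q • θ)
    (hn : n = 2 * m) (hk : k ≤ n) (hc : c * c * (δ⁻¹ ^ m * δ ^ k) = 1)
    (K : Type u) [Field K] [Algebra E₀ K] {y : Cl (K ⊗[E₀] E) n} (hy : y ∈ neutral σ δ k n K)
    (s : Ext (K ⊗[E₀] E) n) (hs : s ∈ SPlus (K ⊗[E₀] E) n) :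
    semi hδ k n c (conj₀ σ K) (spinAct _ n y s) =
      spinAct _ n y (semi hδ k n c (conj₀ σ K) s) := by
  let L (r : K) (s : Ext (K ⊗[E₀] E) n) : Cl (K ⊗[E₀] E) n →ₗ[K] Ext (K ⊗[E₀] E) n :=
    { toFun := fun u => semi hδ k n c (conj₀ σ K) (spinAct _ n u s) -
        (r ⊗ₜ[E₀] (1 : E) : K ⊗[E₀] E) • spinAct _ n u (semi hδ k n c (conj₀ σ K) s)
      map_add' := fun u v => by
        simp only [map_add, LinearMap.add_apply, smul_add]; abel
      map_smul' := fun r u => by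
        have h : conj₀ σ K (algebraMap K (K ⊗[E₀] E) r) = algebraMap K (K ⊗[E₀] E) r :=
          AlgHom.commutes (conj σ K) r
        simp only [← algebraMap_smul (K ⊗[E₀] E) r, map_smul, LinearMap.smul_apply, semi_smul, h,
          smul_sub, smul_comm _ (algebraMap K (K ⊗[E₀] E) r), RingHom.id_apply] }
  let F (r : K) : Set (Cl (K ⊗[E₀] E) n) := ⋂ s ∈ SPlus (K ⊗[E₀] E) n, {u | L r s u = 0}
  let _ := zariski K (Cl (K ⊗[E₀] E) n)
  have hF : ∀ r, IsClosed (F r) := fun r =>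
    isClosed_biInter fun s _ => isClosed_zariski (L r s)
  have hmem : ∀ r u, u ∈ F r ↔ ∀ s ∈ SPlus (K ⊗[E₀] E) n,
      semi hδ k n c (conj₀ σ K) (spinAct _ n u s) =
        (r ⊗ₜ[E₀] (1 : E) : K ⊗[E₀] E) • spinAct _ n u (semi hδ k n c (conj₀ σ K) s) := by
    intro r u
    simp only [F, Set.mem_iInter]
    exact forall₂_congr fun s _ => sub_eq_zero
  have h2K : (2 : K) ≠ 0 := by
    have := (map_ne_zero (algebraMap E₀ K)).mpr h2
    rwa [map_ofNat] at this
  have hcover : neutral σ δ k n K ⊆ F 1 ∪ F (-1) := by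
    intro u hu
    obtain ⟨u, hu', rfl⟩ := exists_of_mem_neutral hu
    obtain ⟨r, hr, h⟩ := exists_sign_of_mem_preG K hδ hσ h2 hθ hspan hn hk hc hu'
    rcases mul_self_eq_one_iff.mp hr with rfl | rfl
    · exact Or.inl ((hmem _ _).mpr h)
    · exact Or.inr ((hmem _ _).mpr h)
  have hdisj : neutral σ δ k n K ∩ (F 1 ∩ F (-1)) = ∅ := by
    refine Set.eq_empty_of_forall_notMem ?_
    rintro u ⟨hu, h1, h1'⟩
    obtain ⟨u, -, rfl⟩ := exists_of_mem_neutral hu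
    have h := ((hmem _ _).mp h1 1 one_mem_sPlus).symm.trans ((hmem _ _).mp h1' 1 one_mem_sPlus)
    have h3 := Algebra.TensorProduct.includeLeft_injective (S := K) (algebraMap E₀ E).injective
      (eq_of_smul_spinAct_semi hδ _ (conj₀_conj₀ K hσ) hn hk hc u h)
    exact h2K (by linear_combination h3)
  have hpre : IsPreconnected (neutral σ δ k n K) := isPreconnected_connectedComponentIn
  have h1F : (1 : Cl (K ⊗[E₀] E) n) ∈ F 1 := by
    rw [hmem]
    intro s _
    rw [map_one, Module.End.one_apply, Module.End.one_apply, ← Algebra.TensorProduct.one_def,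
      one_smul]
  rcases isPreconnected_iff_subset_of_disjoint_closed.mp hpre _ _ (hF 1) (hF (-1)) hcover hdisj with h | h
  · have := (hmem 1 y).mp (h hy) s hs
    rwa [← Algebra.TensorProduct.one_def, one_smul] at this
  · exact absurd (hdisj.subset ⟨one_mem_neutral σ δ k n K, h1F, h (one_mem_neutral σ δ k n K)⟩)
      (Set.notMem_empty _)

theorem map_sign_eq_one_of_mem_G₁ (hσ : ∀ x, σ (σ x) = x) (h2 : (2 : E₀) ≠ 0) {θ : E}
    (hθ : σ θ = -θ) (hspan : ∀ x : E, ∃ p q : E₀, x = algebraMap E₀ E p + q • θ)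
    (hn : n = 2 * m) (hk : k ≤ n) (hc : c * c * (δ⁻¹ ^ m * δ ^ k) = 1)
    {u : (Cl (R ⊗[E₀] E) n)ˣ} (hu : u ∈ G₁ σ δ k n R) (r : R)
    (h : semi hδ k n c (conj₀ σ R) (spinAct _ n u 1) =
      (r ⊗ₜ[E₀] (1 : E) : R ⊗[E₀] E) • spinAct _ n u (semi hδ k n c (conj₀ σ R) 1))
    (K : Type u) [Field K] [IsAlgClosed K] [Algebra E₀ K] (f : R →ₐ[E₀] K) : f r = 1 := by
  let F : R ⊗[E₀] E →ₐ[E₀] K ⊗[E₀] E := Algebra.TensorProduct.map f (AlgHom.id E₀ E)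
  have hF : F.toRingHom (r ⊗ₜ[E₀] (1 : E)) = f r ⊗ₜ[E₀] (1 : E) :=
    Algebra.TensorProduct.map_tmul _ _ _ _
  have h1 : semi hδ k n c (conj₀ σ K) (spinAct _ n (clMap F.toRingHom n u) 1) =
      spinAct _ n (clMap F.toRingHom n u) (semi hδ k n c (conj₀ σ K) 1) :=
    semi_comm_of_mem_neutral hδ hσ h2 hθ hspan hn hk hc K (hu.2 K f) 1 one_mem_sPlus
  have h3 := congrArg (extMap F.toRingHom n) h
  rw [extMap_smul, extMap_semi hδ k c (conj₀ σ R) (conj₀ σ K) F (map_conj₀ R f) _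
    (spinAct_mem _ hu.1.1.1 _ one_mem_sPlus), extMap_spinAct, extMap_spinAct,
    extMap_semi hδ k c (conj₀ σ R) (conj₀ σ K) F (map_conj₀ R f) _ one_mem_sPlus,
    map_one (extMap _ _), h1, hF] at h3
  obtain ⟨u', hu'⟩ : ∃ u' : (Cl (K ⊗[E₀] E) n)ˣ, (u' : Cl (K ⊗[E₀] E) n) =
    clMap F.toRingHom n u := ⟨Units.map (clMap F.toRingHom n).toMonoidHom u, rfl⟩
  rw [← hu'] at h3
  have h4 := eq_of_smul_spinAct_semi hδ _ (conj₀_conj₀ K hσ) hn hk hc u'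
    ((one_smul (K ⊗[E₀] E) _).trans h3)
  rw [Algebra.TensorProduct.one_def] at h4
  exact (Algebra.TensorProduct.includeLeft_injective (S := K) (algebraMap E₀ E).injective h4).symm

/-- At a maximal ideal containing `r + 1`, the algebraic closure of the residue field would give `2
= 0`. So `r + 1` is a unit, and it can be cancelled from `(r + 1)(r - 1) = 0`. -/
theorem eq_one_of_geometric (h2 : (2 : E₀) ≠ 0) {r : R} (hr : r * r = 1)
    (key : ∀ (K : Type u) [Field K] [IsAlgClosed K] [Algebra E₀ K] (f : R →ₐ[E₀] K), f r = 1) :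
    r = 1 := by
  have hunit : IsUnit (r + 1) := by
    by_contra hnu
    obtain ⟨M, hM, hrM⟩ := exists_max_ideal_of_mem_nonunits hnu
    let _ : Field (R ⧸ M) := Ideal.Quotient.field M
    let π : R →+* AlgebraicClosure (R ⧸ M) :=
      (algebraMap (R ⧸ M) (AlgebraicClosure (R ⧸ M))).comp (Ideal.Quotient.mk M)
    let _ : Algebra E₀ (AlgebraicClosure (R ⧸ M)) := (π.comp (algebraMap E₀ R)).toAlgebra
    let f : R →ₐ[E₀] AlgebraicClosure (R ⧸ M) := { π with commutes' := fun _ => rfl }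
    have h1 : f (r + 1) = 0 := by
      change algebraMap (R ⧸ M) _ (Ideal.Quotient.mk M (r + 1)) = 0
      rw [Ideal.Quotient.eq_zero_iff_mem.mpr hrM, map_zero]
    rw [map_add, key _ f, map_one] at h1
    have h3 := (map_ne_zero (algebraMap E₀ (AlgebraicClosure (R ⧸ M)))).mpr h2
    rw [map_ofNat] at h3
    exact h3 (by rw [← h1]; norm_num)
  have h0 : (r + 1) * (r - 1) = (r + 1) * 0 := by linear_combination hr
  exact sub_eq_zero.mp (hunit.mul_left_cancel h0)

theorem semi_comm_of_mem_G₁ (hσ : ∀ x, σ (σ x) = x) (h2 : (2 : E₀) ≠ 0) {θ : E}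
    (hθ : σ θ = -θ) (hspan : ∀ x : E, ∃ p q : E₀, x = algebraMap E₀ E p + q • θ)
    (hn : n = 2 * m) (hk : k ≤ n) (hc : c * c * (δ⁻¹ ^ m * δ ^ k) = 1)
    {u : (Cl (R ⊗[E₀] E) n)ˣ} (hu : u ∈ G₁ σ δ k n R)
    (s : Ext (R ⊗[E₀] E) n) (hs : s ∈ SPlus (R ⊗[E₀] E) n) :
    semi hδ k n c (conj₀ σ R) (spinAct _ n u s) =
      spinAct _ n u (semi hδ k n c (conj₀ σ R) s) := by
  obtain ⟨r, hr, h⟩ := exists_sign_of_mem_preG R hδ hσ h2 hθ hspan hn hk hc hu.1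
  have hr1 : r = 1 := eq_one_of_geometric R h2 hr
    (map_sign_eq_one_of_mem_G₁ R hδ hσ h2 hθ hspan hn hk hc hu r (h 1 one_mem_sPlus))
  rw [h s hs, hr1, ← Algebra.TensorProduct.one_def, one_smul]

end Spin

end Conjugation

/-! ### Extension of scalars of `⋀ W₁` and of `S⁺` -/

section BaseChange

variable {E A : Type u} [Field E] [CommRing A] {n : ℕ}

/-- The standard basis of `⋀ W₁`. -/
def extBasis (A : Type u) [CommRing A] (n : ℕ) : Module.Basis (Finset (Fin n)) A (Ext A n) :=
  (Pi.basisFun A (Fin n)).ExteriorAlgebra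

theorem extMap_extBasis {B : Type u} [CommRing B] (f : A →+* B) (I : Finset (Fin n)) :
    extMap f n (extBasis A n I) = extBasis B n I := by
  rw [extBasis, extBasis, ExteriorAlgebra.basis_apply, ExteriorAlgebra.basis_apply]
  simp only [ExteriorAlgebra.ιMulti_family]
  rw [ExteriorAlgebra.ιMulti_apply, ExteriorAlgebra.ιMulti_apply, map_list_prod, List.map_ofFn]
  congr 2
  ext i
  rw [Function.comp_apply, extMap_ι]
  congr 1
  ext j
  simp [Pi.single_apply]

theorem exists_dual_extMap (f : E →+* A) (d : Module.Dual E (Ext E n)) :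
    ∃ D : Module.Dual A (Ext A n), ∀ s, D (extMap f n s) = f (d s) := by
  refine ⟨(extBasis A n).constr A fun I => f (d (extBasis E n I)), fun s => ?_⟩
  rw [← (extBasis E n).sum_repr s]
  simp only [map_sum, extMap_smul, extMap_extBasis, map_smul, Module.Basis.constr_basis,
    smul_eq_mul, map_mul]

/-- Functionals dual to the given vectors extend to `⋀ E ^ n` and then to `⋀ A ^ n`, where they read
off the coefficients of a relation. No flatness of `A` over `E` is invoked. -/
theorem linearIndependent_extMap (f : E →+* A) {ι : Type u} {v : ι → Ext E n}
    (hv : LinearIndependent E v) : LinearIndependent A fun i => extMap f n (v i) := by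
  classical
  have hd : ∀ i, ∃ d : Module.Dual E (Ext E n), ∀ j, d (v j) = if j = i then 1 else 0 := by
    intro i
    obtain ⟨d, hd⟩ := LinearMap.exists_extend ((Module.Basis.span hv).coord i)
    refine ⟨d, fun j => ?_⟩
    have h := LinearMap.congr_fun hd (Module.Basis.span hv j)
    rw [Module.Basis.coord_apply, Module.Basis.repr_self, Finsupp.single_apply,
      LinearMap.comp_apply, Submodule.subtype_apply, Module.Basis.span_apply] at h
    exact h
  rw [linearIndependent_iff']
  intro s a ha i hi
  obtain ⟨d, hd⟩ := hd i
  obtain ⟨D, hD⟩ := exists_dual_extMap f d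
  have h := congrArg D ha
  rw [map_sum, map_zero] at h
  simpa [hD, hd, hi] using h

theorem mem_span_extMap (f : E →+* A) (s : Ext A n) (hs : s ∈ SPlus A n) :
    s ∈ Submodule.span A (extMap f n '' (SPlus E n : Set (Ext E n))) := by
  have hstep : ∀ i j, ∀ s ∈ Submodule.span A (extMap f n '' (SPlus E n : Set (Ext E n))),
      cre A n i (cre A n j s) ∈ Submodule.span A (extMap f n '' (SPlus E n : Set (Ext E n))) := by
    intro i j s hs
    induction hs using Submodule.span_induction with
    | mem s hs =>
      obtain ⟨t, ht, rfl⟩ := hs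
      rw [← extMap_cre, ← extMap_cre]
      exact Submodule.subset_span ⟨_, vecAct_vecAct_mem _ _ _ ht, rfl⟩
    | zero => simp
    | add s t _ _ hs ht => simpa using Submodule.add_mem _ hs ht
    | smul a s _ hs => simpa using Submodule.smul_mem _ a hs
  refine sPlus_induction
    (p := fun s => s ∈ Submodule.span A (extMap f n '' (SPlus E n : Set (Ext E n))))
    ?_ ?_ ?_ ?_ s hs
  · exact Submodule.subset_span ⟨1, one_mem_sPlus, map_one (extMap f n)⟩
  · exact fun a s _ h => Submodule.smul_mem _ a h
  · exact fun s t _ _ hs ht => Submodule.add_mem _ hs ht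
  · intro x y s _ hs
    simp only [vecAct_incl₁_eq_sum, LinearMap.sum_apply, LinearMap.smul_apply, map_sum, map_smul]
    exact Submodule.sum_mem _ fun i _ => Submodule.smul_mem _ _ (Submodule.sum_mem _ fun j _ =>
      Submodule.smul_mem _ _ (hstep _ _ _ hs))

instance : Module.Finite E (Ext E n) := Module.Finite.of_basis (extBasis E n)

end BaseChange

/-! ### Descent -/

section Descent

variable {E₀ E : Type u} [Field E₀] [Field E] [Algebra E₀ E] {σ : E ≃ₐ[E₀] E}
  {δ : E₀} (hδ : δ ≠ 0) (k n : ℕ) (c : E₀)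

variable (σ) in
/-- The `E₀`-structure on `S⁺`: the vectors that are fixed by the semilinear structure. -/
def fixedSpace : Submodule E₀ (Ext E n) where
  carrier := {s | s ∈ SPlus E n ∧ semi hδ k n c (σ : E →ₐ[E₀] E) s = s}
  zero_mem' := ⟨Submodule.zero_mem _, map_zero _⟩
  add_mem' := fun hs ht => ⟨Submodule.add_mem _ hs.1 ht.1, by rw [map_add, hs.2, ht.2]⟩
  smul_mem' := fun a s hs => by
    rw [← algebraMap_smul E a s]
    refine ⟨Submodule.smul_mem _ _ hs.1, ?_⟩
    rw [semi_smul, hs.2, AlgHom.commutes]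

variable (σ) in
/-- The inclusion of the `E₀`-structure in `S⁺`. -/
def fixedIncl : fixedSpace σ hδ k n c →ₗ[E₀] SPlus E n where
  toFun v := ⟨v, v.2.1⟩
  map_add' _ _ := rfl
  map_smul' _ _ := rfl

variable {k n c} {m : ℕ}

/-- This is descent along a quadratic extension. The decomposition `s = (s + Js)/2 + θ · (s -
Js)/(2θ)` has both parts fixed by `J`, and for injectivity `J` turns `v + θw = 0` into `v - θw = 0`.
-/
theorem fixedIncl_baseChange_bijective (hσ : ∀ x, σ (σ x) = x) (h2 : (2 : E₀) ≠ 0) {θ : E}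
    (hθ0 : θ ≠ 0) (hθ : σ θ = -θ)
    (hspan : ∀ x : E, ∃ p q : E₀, x = algebraMap E₀ E p + q • θ)
    (hn : n = 2 * m) (hk : k ≤ n) (hc : c * c * (δ⁻¹ ^ m * δ ^ k) = 1) :
    Function.Bijective (LinearMap.liftBaseChange E (fixedIncl σ hδ k n c)) := by
  have hev : Even n := ⟨m, by rw [hn, two_mul]⟩
  have h2E : (2 : E) ≠ 0 := by
    have := (map_ne_zero (algebraMap E₀ E)).mpr h2
    rwa [map_ofNat] at this
  have hσ' : ∀ x, (σ : E →ₐ[E₀] E) ((σ : E →ₐ[E₀] E) x) = x := hσ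
  have hθ' : (σ : E →ₐ[E₀] E) θ = -θ := hθ
  constructor
  · rw [injective_iff_map_eq_zero]
    intro x hx
    have hall : ∀ x : E ⊗[E₀] fixedSpace σ hδ k n c, ∃ v w, x = 1 ⊗ₜ v + θ ⊗ₜ w := by
      intro x
      induction x with
      | zero => exact ⟨0, 0, by simp⟩
      | add x y hx hy =>
        obtain ⟨v, w, rfl⟩ := hx
        obtain ⟨v', w', rfl⟩ := hy
        exact ⟨v + v', w + w', by rw [TensorProduct.tmul_add, TensorProduct.tmul_add]; abel⟩
      | tmul e v =>
        obtain ⟨p, q, rfl⟩ := hspan e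
        refine ⟨p • v, q • v, ?_⟩
        rw [TensorProduct.add_tmul, Algebra.algebraMap_eq_smul_one, TensorProduct.smul_tmul,
          TensorProduct.smul_tmul]
    obtain ⟨v, w, rfl⟩ := hall x
    have h1 : (v : Ext E n) + θ • (w : Ext E n) = 0 := by
      have := congrArg Subtype.val hx
      simpa [fixedIncl] using this
    have h3 := congrArg (semi hδ k n c (σ : E →ₐ[E₀] E)) h1
    rw [map_add, semi_smul, v.2.2, w.2.2, hθ', map_zero, neg_smul] at h3
    have hv : (v : Ext E n) = 0 := by
      have h4 : (2 : E) • (v : Ext E n) = 0 := by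
        rw [two_smul]
        calc (v : Ext E n) + v = (v + θ • (w : Ext E n)) + (v + -(θ • (w : Ext E n))) := by abel
          _ = 0 := by rw [h1, h3, add_zero]
      exact (smul_eq_zero_iff_right h2E).mp h4
    have hw : (w : Ext E n) = 0 := by
      rw [hv, zero_add] at h1
      exact (smul_eq_zero_iff_right hθ0).mp h1
    rw [show v = 0 from Subtype.ext hv, show w = 0 from Subtype.ext hw]
    simp
  · rintro ⟨s, hs⟩
    set J := semi hδ k n c (σ : E →ₐ[E₀] E) with hJ
    have hJm : J s ∈ SPlus E n := semi_mem hδ k c _ hev s hs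
    have hJJ : J (J s) = s := semi_semi hδ _ hσ' hn hk hc s hs
    have hJs : ∀ (a : E) t, J (a • t) = σ a • J t := semi_smul hδ k c _
    have h2σ : σ (2⁻¹ : E) = 2⁻¹ := by rw [map_inv₀, map_ofNat]
    let v : fixedSpace σ hδ k n c := ⟨(2⁻¹ : E) • (s + J s),
      Submodule.smul_mem _ _ (Submodule.add_mem _ hs hJm), by
        rw [← hJ, hJs, map_add, hJJ, h2σ, add_comm]⟩
    let w : fixedSpace σ hδ k n c := ⟨(θ⁻¹ * 2⁻¹ : E) • (s - J s),
      Submodule.smul_mem _ _ (Submodule.sub_mem _ hs hJm), by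
        rw [← hJ, hJs, map_sub, hJJ, map_mul, map_inv₀, hθ, h2σ, inv_neg, neg_mul, neg_smul,
          ← smul_neg, neg_sub]⟩
    refine ⟨1 ⊗ₜ v + θ ⊗ₜ w, Subtype.ext ?_⟩
    simp only [map_add, LinearMap.liftBaseChange_tmul, one_smul, Submodule.coe_add,
      Submodule.coe_smul]
    change (2⁻¹ : E) • (s + J s) + θ • ((θ⁻¹ * 2⁻¹ : E) • (s - J s)) = s
    rw [smul_smul, mul_inv_cancel_left₀ hθ0, ← smul_add, add_add_sub_cancel, ← two_smul E s,
      smul_smul, inv_mul_cancel₀ h2E, one_smul]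

/-- The isomorphism `E ⊗ V ≃ S⁺`. -/
def fixedEquiv
    (h : Function.Bijective (LinearMap.liftBaseChange E (fixedIncl σ hδ k n c))) :
    E ⊗[E₀] fixedSpace σ hδ k n c ≃ₗ[E] SPlus E n :=
  LinearEquiv.ofBijective _ h

variable (R : Type u) [CommRing R] [Algebra E₀ R]

variable {hδ}

theorem extend_tmul (h : Function.Bijective (LinearMap.liftBaseChange E (fixedIncl σ hδ k n c)))
    (r : R) (v : fixedSpace σ hδ k n c) :
    (extend (fixedEquiv hδ h).toLinearMap R (r ⊗ₜ v) : Ext (R ⊗[E₀] E) n) =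
      (r ⊗ₜ[E₀] (1 : E) : R ⊗[E₀] E) •
        extMap (Algebra.TensorProduct.includeRight : E →ₐ[E₀] R ⊗[E₀] E).toRingHom n v := by
  have h1 : fixedEquiv hδ h (1 ⊗ₜ v) = fixedIncl σ hδ k n c v := by
    simp [fixedEquiv]
  rw [extend, LinearMap.liftBaseChange_tmul]
  change ((r • sPlusMap _ n (fixedEquiv hδ h (1 ⊗ₜ v)) : SPlus (R ⊗[E₀] E) n) :
    Ext (R ⊗[E₀] E) n) = _
  rw [h1, ← algebraMap_smul (R ⊗[E₀] E) r]
  rfl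

theorem semi_extMap_fixed (v : fixedSpace σ hδ k n c) :
    semi hδ k n c (conj₀ σ R) (extMap (Algebra.TensorProduct.includeRight :
      E →ₐ[E₀] R ⊗[E₀] E).toRingHom n v) =
      extMap (Algebra.TensorProduct.includeRight : E →ₐ[E₀] R ⊗[E₀] E).toRingHom n v := by
  rw [← extMap_semi hδ k c (σ : E →ₐ[E₀] E) (conj₀ σ R) Algebra.TensorProduct.includeRight
    (fun a => by simp [conj₀_tmul]) _ v.2.1, v.2.2]

theorem semi_extend
    (h : Function.Bijective (LinearMap.liftBaseChange E (fixedIncl σ hδ k n c)))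
    (x : R ⊗[E₀] fixedSpace σ hδ k n c) :
    semi hδ k n c (conj₀ σ R) (extend (fixedEquiv hδ h).toLinearMap R x) =
      extend (fixedEquiv hδ h).toLinearMap R x := by
  induction x with
  | zero => simp
  | add x y hx hy => simp only [map_add, Submodule.coe_add, hx, hy]
  | tmul r v => rw [extend_tmul, semi_smul, conj₀_tmul, map_one, semi_extMap_fixed]

instance [FiniteDimensional E₀ E] : FiniteDimensional E₀ (fixedSpace σ hδ k n c) := by
  have : Module.Finite E₀ (Ext E n) := Module.Finite.trans E _
  infer_instance

theorem linearIndependent_fixed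
    (h : Function.Bijective (LinearMap.liftBaseChange E (fixedIncl σ hδ k n c)))
    {ι : Type u} (v : Module.Basis ι E₀ (fixedSpace σ hδ k n c)) :
    LinearIndependent (R ⊗[E₀] E) fun i => extMap (Algebra.TensorProduct.includeRight :
      E →ₐ[E₀] R ⊗[E₀] E).toRingHom n (v i : Ext E n) := by
  refine linearIndependent_extMap _ ?_
  have h1 := (((v.baseChange E).map (fixedEquiv hδ h)).linearIndependent).map'
    (SPlus E n).subtype (Submodule.ker_subtype _)
  have h3 : (fun i => (v i : Ext E n)) =
      (SPlus E n).subtype ∘ (v.baseChange E).map (fixedEquiv hδ h) := by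
    ext i
    simp [fixedEquiv, fixedIncl]
  rw [h3]
  exact h1

theorem extend_injective [FiniteDimensional E₀ E]
    (h : Function.Bijective (LinearMap.liftBaseChange E (fixedIncl σ hδ k n c))) :
    Function.Injective (extend (fixedEquiv hδ h).toLinearMap R) := by
  rw [injective_iff_map_eq_zero]
  intro x hx
  let v := Module.Free.chooseBasis E₀ (fixedSpace σ hδ k n c)
  have hx' := congrArg Subtype.val hx
  rw [← (v.baseChange R).sum_repr x] at hx' ⊢
  refine Finset.sum_eq_zero fun i _ => ?_
  have hli := Fintype.linearIndependent_iff.mp (linearIndependent_fixed R h v)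
    (fun i => ((v.baseChange R).repr x i) ⊗ₜ[E₀] (1 : E)) (by
      rw [← Submodule.coe_zero (p := SPlus (R ⊗[E₀] E) n), ← hx', map_sum, Submodule.coe_sum]
      refine Finset.sum_congr rfl fun i _ => ?_
      rw [Module.Basis.baseChange_apply, TensorProduct.smul_tmul', smul_eq_mul, mul_one,
        extend_tmul]) i
  have h0 : (v.baseChange R).repr x i = 0 :=
    Algebra.TensorProduct.includeLeft_injective (S := R) (algebraMap E₀ E).injective
      (hli.trans (map_zero _).symm)
  rw [h0, zero_smul]

/-- A basis of `V` remains independent over `R ⊗ E` and spans the extended `S⁺`. Its members are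
fixed by `J`, so the coefficients of a fixed vector are invariant under conjugation and lie in `R`.
-/
theorem exists_extend_eq [FiniteDimensional E₀ E] (h2 : (2 : E₀) ≠ 0) {θ : E}
    (hθ : σ θ = -θ) (hspan : ∀ x : E, ∃ p q : E₀, x = algebraMap E₀ E p + q • θ)
    (h : Function.Bijective (LinearMap.liftBaseChange E (fixedIncl σ hδ k n c)))
    (s : SPlus (R ⊗[E₀] E) n) (hs : semi hδ k n c (conj₀ σ R) s = s) :
    ∃ x, extend (fixedEquiv hδ h).toLinearMap R x = s := by
  let v := Module.Free.chooseBasis E₀ (fixedSpace σ hδ k n c)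
  let f := (Algebra.TensorProduct.includeRight : E →ₐ[E₀] R ⊗[E₀] E).toRingHom
  have hli := linearIndependent_fixed R h v
  have hspan' : (s : Ext (R ⊗[E₀] E) n) ∈ Submodule.span (R ⊗[E₀] E)
      (Set.range fun i => extMap f n (v i : Ext E n)) := by
    have hs' := mem_span_extMap (A := R ⊗[E₀] E) (n := n) f s s.2
    refine Submodule.span_le.mpr ?_ hs'
    rintro _ ⟨t, ht, rfl⟩
    obtain ⟨x, hx⟩ := h.2 ⟨t, ht⟩
    have hx' := congrArg Subtype.val hx
    rw [← (v.baseChange E).sum_repr x, map_sum, Submodule.coe_sum] at hx'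
    rw [SetLike.mem_coe, ← show _ = t from hx', map_sum]
    refine Submodule.sum_mem _ fun i _ => ?_
    rw [map_smul, Submodule.coe_smul, extMap_smul]
    refine Submodule.smul_mem _ _ (Submodule.subset_span ⟨i, ?_⟩)
    simp [fixedIncl]
  obtain ⟨a, ha⟩ := (Submodule.mem_span_range_iff_exists_fun _).mp hspan'
  have hfix : ∀ i, conj₀ σ R (a i) = a i := by
    intro i
    rw [← ha, map_sum] at hs
    simp only [semi_smul] at hs
    have hs' : ∑ i, conj₀ σ R (a i) • extMap f n (v i : Ext E n) =
        ∑ i, a i • extMap f n (v i : Ext E n) := by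
      rw [← hs]
      exact Finset.sum_congr rfl fun i _ => by rw [semi_extMap_fixed R (v i)]
    have h0 := Fintype.linearIndependent_iff.mp hli (fun i => conj₀ σ R (a i) - a i) (by
      simp only [sub_smul, Finset.sum_sub_distrib]
      exact sub_eq_zero.mpr hs') i
    exact sub_eq_zero.mp h0
  choose r hr using fun i => exists_tmul_one_of_conj₀ R h2 hθ hspan (a i) (hfix i)
  refine ⟨∑ i, r i ⊗ₜ v i, Subtype.ext ?_⟩
  rw [map_sum, Submodule.coe_sum, ← ha]
  exact Finset.sum_congr rfl fun i _ => by rw [extend_tmul, hr i]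

theorem extend_rTensor {R' : Type u} [CommRing R'] [Algebra E₀ R'] (f : R →ₐ[E₀] R')
    (h : Function.Bijective (LinearMap.liftBaseChange E (fixedIncl σ hδ k n c)))
    (x : R ⊗[E₀] fixedSpace σ hδ k n c) :
    (extend (fixedEquiv hδ h).toLinearMap R' (f.toLinearMap.rTensor _ x) :
      Ext (R' ⊗[E₀] E) n) =
      extMap (Algebra.TensorProduct.map f (AlgHom.id E₀ E)).toRingHom n
        (extend (fixedEquiv hδ h).toLinearMap R x : Ext (R ⊗[E₀] E) n) := by
  induction x with
  | zero => simp
  | add x y hx hy => simp only [map_add, Submodule.coe_add, hx, hy]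
  | tmul r v =>
    have hf : (Algebra.TensorProduct.map f (AlgHom.id E₀ E)).toRingHom.comp
        (Algebra.TensorProduct.includeRight : E →ₐ[E₀] R ⊗[E₀] E).toRingHom =
        (Algebra.TensorProduct.includeRight : E →ₐ[E₀] R' ⊗[E₀] E).toRingHom :=
      RingHom.ext fun e => by simp
    rw [LinearMap.rTensor_tmul, extend_tmul, extend_tmul, extMap_smul, extMap_extMap, hf]
    rfl

theorem exists_act [FiniteDimensional E₀ E] (hσ : ∀ x, σ (σ x) = x) (h2 : (2 : E₀) ≠ 0)
    {θ : E} (hθ : σ θ = -θ)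
    (hspan : ∀ x : E, ∃ p q : E₀, x = algebraMap E₀ E p + q • θ)
    (hn : n = 2 * m) (hk : k ≤ n) (hc : c * c * (δ⁻¹ ^ m * δ ^ k) = 1)
    (h : Function.Bijective (LinearMap.liftBaseChange E (fixedIncl σ hδ k n c))) :
    ∃ act : G₁ σ δ k n R →* Module.End R (R ⊗[E₀] fixedSpace σ hδ k n c), ∀ g x,
      extend (fixedEquiv hδ h).toLinearMap R (act g x) =
        sPlusAct σ δ k n R g (extend (fixedEquiv hδ h).toLinearMap R x) := by
  have hinj := extend_injective R h
  have hex : ∀ (g : G₁ σ δ k n R) (x : R ⊗[E₀] fixedSpace σ hδ k n c),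
      ∃ y, extend (fixedEquiv hδ h).toLinearMap R y =
        sPlusAct σ δ k n R g (extend (fixedEquiv hδ h).toLinearMap R x) := by
    intro g x
    -- The image of `R ⊗ V` consists of vectors fixed by `J`, and group elements commute with `J`,
    -- so they preserve this image.
    refine exists_extend_eq R h2 hθ hspan h _ ?_
    have h3 := semi_comm_of_mem_G₁ R hδ hσ h2 hθ hspan hn hk hc g.2
      (extend (fixedEquiv hδ h).toLinearMap R x) (SetLike.coe_mem _)
    rw [semi_extend] at h3
    exact h3
  generalize (fixedEquiv hδ h).toLinearMap = φ at *
  choose a ha using hex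
  refine ⟨
    { toFun := fun g =>
        { toFun := a g
          map_add' := fun x y => hinj (by simp only [map_add, ha])
          map_smul' := fun r x => hinj (by
            rw [ha, map_smul, LinearMap.map_smul_of_tower, RingHom.id_apply, map_smul, ha]) }
      map_one' := LinearMap.ext fun x => hinj (by
        change extend φ R (a 1 x) = extend φ R x
        rw [ha, map_one, Module.End.one_apply])
      map_mul' := fun g g' => LinearMap.ext fun x => hinj (by
        change extend φ R (a (g * g') x) = extend φ R (a g (a g' x))
        rw [ha, ha, ha, map_mul, Module.End.mul_apply]) }, ha⟩

theorem coe_sPlusAct (g : G₁ σ δ k n R) (s : SPlus (R ⊗[E₀] E) n) :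
    (sPlusAct σ δ k n R g s : Ext (R ⊗[E₀] E) n) =
      spinAct _ n ((g : (Cl (R ⊗[E₀] E) n)ˣ) : Cl (R ⊗[E₀] E) n) s := rfl

theorem sPlusDefinedOver_of_sq [FiniteDimensional E₀ E] (hδ : δ ≠ 0) (hσ : ∀ x, σ (σ x) = x)
    (h2 : (2 : E₀) ≠ 0) {θ : E} (hθ0 : θ ≠ 0) (hθ : σ θ = -θ)
    (hspan : ∀ x : E, ∃ p q : E₀, x = algebraMap E₀ E p + q • θ)
    (hn : n = 2 * m) (hk : k ≤ n) (hc : c * c * (δ⁻¹ ^ m * δ ^ k) = 1) :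
    SPlusDefinedOver σ δ k n := by
  have h := fixedIncl_baseChange_bijective hδ hσ h2 hθ0 hθ hspan hn hk hc
  choose act hact using fun (R : Type u) [CommRing R] [Algebra E₀ R] =>
    exists_act R hσ h2 hθ hspan hn hk hc h
  refine ⟨fixedSpace σ hδ k n c, inferInstance, inferInstance, inferInstance,
    ⟨act, fun R R' _ _ _ _ f g g' hg x => extend_injective R' h (Subtype.ext ?_)⟩,
    fixedEquiv hδ h, hact⟩
  rw [hact, extend_rTensor, hact, coe_sPlusAct, coe_sPlusAct, extMap_spinAct, extend_rTensor, hg]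

end Descent

/-! ### Quadratic extensions -/

section Quadratic

variable {E₀ E : Type u} [Field E₀] [Field E] [Algebra E₀ E]

theorem exists_generator_of_finrank_eq_two (hE : Module.finrank E₀ E = 2) (h2 : (2 : E₀) ≠ 0)
    (σ : E ≃ₐ[E₀] E) (hσ : σ ≠ AlgEquiv.refl) :
    (∀ x, σ (σ x) = x) ∧ ∃ θ : E, θ ≠ 0 ∧ σ θ = -θ ∧
      ∀ x : E, ∃ p q : E₀, x = algebraMap E₀ E p + q • θ := by
  have : FiniteDimensional E₀ E := FiniteDimensional.of_finrank_eq_succ hE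
  -- There are at most two automorphisms because the degree is two, and `σ` is not the identity, so
  -- the group has order two.
  have hσσ : ∀ x, σ (σ x) = x := by
    have h1 : Nat.card (E ≃ₐ[E₀] E) ≤ 2 := by
      rw [Nat.card_eq_fintype_card, ← hE]
      exact AlgEquiv.card_le
    have : Nontrivial (E ≃ₐ[E₀] E) := ⟨σ, AlgEquiv.refl, hσ⟩
    have h3 : Nat.card (E ≃ₐ[E₀] E) = 2 := le_antisymm h1 (Finite.one_lt_card)
    have h4 : σ ^ 2 = 1 := by rw [← h3]; exact pow_card_eq_one'
    intro x
    rw [pow_two] at h4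
    exact DFunLike.congr_fun h4 x
  obtain ⟨x, hx⟩ : ∃ x, σ x ≠ x := by
    by_contra! h
    exact hσ (AlgEquiv.ext h)
  have h2E : (2 : E) ≠ 0 := by
    have := (map_ne_zero (algebraMap E₀ E)).mpr h2
    rwa [map_ofNat] at this
  have hθ : σ (x - σ x) = -(x - σ x) := by rw [map_sub, hσσ, neg_sub]
  have hθ0 : x - σ x ≠ 0 := sub_ne_zero.mpr hx.symm
  refine ⟨hσσ, x - σ x, hθ0, hθ, fun y => ?_⟩
  generalize x - σ x = θ at hθ hθ0
  have hli : LinearIndependent E₀ ![(1 : E), θ] := by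
    rw [LinearIndependent.pair_iff]
    intro p q h
    have h' := congrArg σ h
    rw [map_add, map_smul, map_smul, map_one, hθ, map_zero, smul_neg] at h'
    have hp : (2 : E) * (p • (1 : E)) = 0 := by linear_combination h + h'
    have hp' := (mul_eq_zero.mp hp).resolve_left h2E
    rw [hp', zero_add] at h
    exact ⟨(smul_eq_zero.mp hp').resolve_right one_ne_zero, (smul_eq_zero.mp h).resolve_right hθ0⟩
  have hy : y ∈ Submodule.span E₀ (Set.range ![(1 : E), θ]) := by
    rw [hli.span_eq_top_of_card_eq_finrank (by rw [hE, Fintype.card_fin])]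
    exact Submodule.mem_top
  rw [Matrix.range_cons, Matrix.range_cons, Matrix.range_empty, Set.union_empty,
    Set.singleton_union, Submodule.mem_span_pair] at hy
  obtain ⟨p, q, rfl⟩ := hy
  exact ⟨p, q, by rw [Algebra.algebraMap_eq_smul_one]⟩

/-- The constant to be cancelled is `δ ^ (k - m)`, an even power of `δ`; half of the opposite
exponent gives `c`. -/
theorem exists_sq_of_modEq {δ : E₀} (hδ : δ ≠ 0) {m k : ℕ} (h : m ≡ k [MOD 2]) :
    ∃ c : E₀, c * c * (δ⁻¹ ^ m * δ ^ k) = 1 := by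
  rcases le_total m k with hmk | hmk
  · obtain ⟨j, hj⟩ := (Nat.modEq_iff_dvd' hmk).mp h
    obtain rfl : k = m + 2 * j := by omega
    exact ⟨δ⁻¹ ^ j, by simp only [inv_pow]; field_simp; ring⟩
  · obtain ⟨j, hj⟩ := (Nat.modEq_iff_dvd' hmk).mp h.symm
    obtain rfl : m = k + 2 * j := by omega
    exact ⟨δ ^ j, by simp only [inv_pow]; field_simp; ring⟩

end Quadratic

end HalfSpin

end

theorem mainTheorem5 (E₀ E : Type u) [Field E₀] [Field E] [Algebra E₀ E]
    (hE : HalfSpin.ImaginaryQuadratic E₀ E) (σ : E ≃ₐ[E₀] E) (hσ : σ ≠ AlgEquiv.refl)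
    (δ : E₀) (hδ : δ ≠ 0) :
    (∀ n m k : ℕ, 1 ≤ k → k ≤ n → n = 2 * m → m ≡ k [MOD 2] →
      HalfSpin.SPlusDefinedOver σ δ k n) ∧
    HalfSpin.SPlusDefinedOver σ δ 1 6 := by
  have h2 : (2 : E₀) ≠ 0 := by
    rcases hE.2 with ⟨h, -⟩ | ⟨⟨e⟩⟩
    · have := h.to_charZero
      exact two_ne_zero
    · intro h
      have := congrArg e h
      rw [map_ofNat, map_zero] at this
      exact two_ne_zero this
  have : FiniteDimensional E₀ E := FiniteDimensional.of_finrank_eq_succ hE.1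
  obtain ⟨hσσ, θ, hθ0, hθ, hspan⟩ :=
    HalfSpin.exists_generator_of_finrank_eq_two hE.1 h2 σ hσ
  have main : ∀ n m k : ℕ, 1 ≤ k → k ≤ n → n = 2 * m → m ≡ k [MOD 2] →
      HalfSpin.SPlusDefinedOver σ δ k n := by
    intro n m k _ hk hn hm
    obtain ⟨c, hc⟩ := HalfSpin.exists_sq_of_modEq hδ hm
    exact HalfSpin.sPlusDefinedOver_of_sq hδ hσσ h2 hθ0 hθ hspan hn hk hc
  -- For `n = 6` one has `m = 3`, which is congruent to `k = 1` modulo 2.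
  exact ⟨main, main 6 3 1 le_rfl (by norm_num) rfl rfl⟩
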